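/- Let $M$ be a smooth finite-dimensional manifold, $\mathfrak X^a(M)=\Gamma(M,\wedge^aTM)$ the multivector fields of degree $a\ge 0$ and $\Omega^\bullet(M)$ the differential forms. Write $xy$ for $x\wedge y$ and $|x|$ for the degree of $x$. Conventions. The contraction is $\iota_X\alpha=\alpha(X,-)$ for a vector field $X$, extended multiplicatively, so that $\iota_{xy}=\iota_x\iota_y$, i.e. $\iota_{X_1\cdots X_k}\alpha=\alpha(X_k,\dots,X_1,-)$. The Lie derivative along $x$ is the graded commutator $\mathcal L_x=d\,\iota_x-(-1)^{|x|}\iota_x\,d$. Let $[\cdot,\cdot]$ be the Schouten bracket, the unique Gerstenhaber bracket on multivector fields extending the Lie bracket of vector fields; thus $[X_1\cdots X_k,Y_1\cdots Y_l]=\sum_{i,j}(-1)^{i+j}[X_i,Y_j]X_1\cdots\widehat{X_i}\cdots X_kY_1\cdots\widehat{Y_j}\cdots Y_l$ for vector fields $X_i,Y_j$, and $[X,f]=X(f)$ for a function $f$; put $\nu(x,y)=(-1)^{|x|-1}[x,y]$. For $0\le p\le n$ let $\mathrm{Sh}(p,n-p)$ be the set of permutations $\sigma$ of $\{1,\dots,n\}$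 with $\sigma(1)<\dots<\sigma(p)$ and $\sigma(p+1)<\dots<\sigma(n)$, and for homogeneous $x_1,\dots,x_n$ let $\epsilon(\sigma)=\prod_{i<j,\ \sigma(i)>\sigma(j)}(-1)^{|x_{\sigma(i)}||x_{\sigma(j)}|}$ be the Koszul sign. Put $\nu_1=0$ and, for $n\ge 2$, $$\nu_n(x_1,\dots,x_n)=\sum_{\sigma\in\mathrm{Sh}(2,n-2)}\epsilon(\sigma)\,\nu(x_{\sigma(1)},x_{\sigma(2)})\,x_{\sigma(3)}\cdots x_{\sigma(n)} .$$ Let $n\ge 1$, let $x_1,\dots,x_n$ be homogeneous multivector fields on $M$, and let $x=x_1\cdots x_n$, of degree $|x|=\sum_i|x_i|$. (a) As operators on $\Omega^\bullet(M)$, $$\mathcal L_x-\iota_{\nu_n(x_1,\dots,x_n)}=(-1)^{|x|}\sum_{\sigma\in \mathrm{Sh}(n-1,1)}\epsilon(\sigma)\,(-1)^{|x_{\sigma(n)}|}\,\iota_{x_{\sigma(1)}\cdots x_{\sigma(n-1)}}\,\mathcal L_{x_{\sigma(n)}} .$$ (b) Let $\omega\in\Omega^{m+1}(M)$ be closed ($m\ge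 0$), i.e. $(M,\omega)$ is a pre-$m$-symplectic manifold. Then $$d\,\iota_x\omega-\iota_{\nu_n(x_1,\dots,x_n)}\omega=(-1)^{|x|}\sum_{\sigma\in \mathrm{Sh}(n-1,1)}\epsilon(\sigma)\,(-1)^{|x_{\sigma(n)}|}\,\iota_{x_{\sigma(1)}\cdots x_{\sigma(n-1)}}\,d\,\iota_{x_{\sigma(n)}}\omega .$$ If moreover every $x_i$ is multisymplectic, i.e. $\mathcal L_{x_i}\omega=0$ for all $i$, then $d\,\iota_x\omega=\iota_{\nu_n(x_1,\dots,x_n)}\omega$. -/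

import Mathlib

open scoped Manifold ContDiff

noncomputable section

namespace Multisymplectic

/-! ### Linear algebra: contraction of alternating forms by multivectors -/

section LinearAlgebra

variable (E : Type*) [NormedAddCommGroup E] [NormedSpace ℝ E]

/-- The graded space of alternating forms on `E`, as the family of its components. (If `E` is finite
dimensional, only finitely many components are nonzero, so this is also the direct sum.) -/
abbrev AltForms : Type _ := (k : ℕ) → E [⋀^Fin k]→L[ℝ] ℝ

/-- Contraction by a vector, `(ι_v α)(v₁, …, v_k) = α(v, v₁, …, v_k)`, as a linear function of `v`
with values in the endomorphisms of the space of alternating forms. -/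
def contractVec : E →ₗ[ℝ] Module.End ℝ (AltForms E) where
  toFun v :=
    { toFun := fun α k => (α (k + 1)).curryLeft v
      map_add' := fun _ _ => rfl
      map_smul' := fun _ _ => rfl }
  map_add' v w := by
    refine LinearMap.ext fun α => funext fun k => ?_
    exact map_add ((α (k + 1)).curryLeft) v w
  map_smul' c v := by
    refine LinearMap.ext fun α => funext fun k => ?_
    exact map_smul ((α (k + 1)).curryLeft) c v

theorem contractVec_mul_self (v : E) : contractVec E v * contractVec E v = 0 := by
  refine LinearMap.ext fun α => funext fun k => ?_
  exact (α (k + 1 + 1)).curryLeft_same v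

/-- Contraction by a multivector: the algebra homomorphism from the exterior algebra to the
endomorphisms of the space of forms that extends the contraction by vectors. Hence
`ι_{v₁ ⋯ vₙ} = ι_{v₁} ∘ ⋯ ∘ ι_{vₙ}`, that is `ι_{v₁ ⋯ vₙ} α = α(vₙ, …, v₁, -)`. -/
def contractMultivector : ExteriorAlgebra ℝ E →ₐ[ℝ] Module.End ℝ (AltForms E) :=
  ExteriorAlgebra.lift ℝ ⟨contractVec E, contractVec_mul_self E⟩

end LinearAlgebra

/-! ### Fields of multivectors and of forms on a manifold -/

section Fields

variable (E : Type*) [NormedAddCommGroup E] [NormedSpace ℝ E]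
  (M : Type*) [TopologicalSpace M] [ChartedSpace E M]

/-- A field of (inhomogeneous) multivectors on `M`: an element of `⋀ T_pM` at every point `p`.
Sums and products (wedge products) are pointwise. No regularity is required here. -/
abbrev MvField : Type _ := (p : M) → ExteriorAlgebra ℝ (TangentSpace 𝓘(ℝ, E) p)

/-- A field of (inhomogeneous) alternating forms on `M`: at every point `p` an alternating `k`-form
on `T_pM` for every `k`. No regularity is required here. -/
abbrev FormField : Type _ := (p : M) → (k : ℕ) → (TangentSpace 𝓘(ℝ, E) p) [⋀^Fin k]→L[ℝ] ℝ

variable {E M}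
variable {N : Type*} [TopologicalSpace N] [ChartedSpace E N]

/-- Pullback of a field of multivectors under a map (meant for local diffeomorphisms),
through the inverse of the derivative. -/
def MvField.pullback (f : M → N) (P : MvField E N) : MvField E M := fun p =>
  ExteriorAlgebra.map ((mfderiv 𝓘(ℝ, E) 𝓘(ℝ, E) f p).inverse :
    TangentSpace 𝓘(ℝ, E) (f p) →ₗ[ℝ] TangentSpace 𝓘(ℝ, E) p) (P (f p))

/-- Pullback of a field of forms under a map. -/
def FormField.pullback (f : M → N) (w : FormField E N) : FormField E M := fun p k =>
  (w (f p) k).compContinuousLinearMap (mfderiv 𝓘(ℝ, E) 𝓘(ℝ, E) f p)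

/-- A field of multivectors is smooth if its components in every chart are smooth. -/
def MvField.IsSmooth (P : MvField E M) : Prop :=
  ∀ (p : M) (φ : Module.Dual ℝ (ExteriorAlgebra ℝ E)),
    ContDiffOn ℝ ∞ (fun y : E => φ (MvField.pullback (extChartAt 𝓘(ℝ, E) p).symm P y))
      (extChartAt 𝓘(ℝ, E) p).target

/-- The `k`-form component of a field of forms on the model space, as a function. -/
def FormField.modelRep (w : FormField E E) (k : ℕ) : E → E [⋀^Fin k]→L[ℝ] ℝ := fun y => w y k

/-- A field of forms is smooth if its components in every chart are smooth. The smooth fields of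
forms are the elements of `Ω^•(M)`. -/
def FormField.IsSmooth (w : FormField E M) : Prop :=
  ∀ (p : M) (k : ℕ),
    ContDiffOn ℝ ∞ ((FormField.pullback (extChartAt 𝓘(ℝ, E) p).symm w).modelRep k)
      (extChartAt 𝓘(ℝ, E) p).target

/-- A field of forms is homogeneous of degree `k`. -/
def FormField.IsHomogeneous (k : ℕ) (w : FormField E M) : Prop :=
  ∀ (p : M) (l : ℕ), l ≠ k → w p l = 0

variable (E M) in
/-- Multivector fields of degree `a`: smooth sections of `⋀^a TM`. -/
structure MultivectorField (a : ℕ) where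
  toFun : MvField E M
  mem_exteriorPower : ∀ p, toFun p ∈ ⋀[ℝ]^a (TangentSpace 𝓘(ℝ, E) p)
  isSmooth : toFun.IsSmooth

/-- Pointwise contraction of a field of forms by a field of multivectors. -/
def contract (P : MvField E M) (w : FormField E M) : FormField E M := fun p =>
  contractMultivector E (P p : ExteriorAlgebra ℝ E) (w p)

/-- The exterior derivative of a field of forms on the model space. -/
def extDerivModel (w : FormField E E) : FormField E E := fun y k =>
  match k with
  | 0 => 0
  | k + 1 => (extDeriv (w.modelRep k) (y : E) : E [⋀^Fin (k + 1)]→L[ℝ] ℝ)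

/-- The exterior derivative on `M`: at a point `p` it is computed in the preferred chart at `p`.
(This is how Mathlib defines the Lie bracket of vector fields on a manifold.) -/
def d (w : FormField E M) : FormField E M := fun p =>
  FormField.pullback (extChartAt 𝓘(ℝ, E) p)
    (extDerivModel (FormField.pullback (extChartAt 𝓘(ℝ, E) p).symm w)) p

/-- The Lie derivative along a field `P` of multivectors of degree `a`: the graded commutator
`L_P = [d, ι_P] = d ι_P - (-1)^a ι_P d`. -/
def lieDerivative (a : ℕ) (P : MvField E M) (w : FormField E M) : FormField E M :=
  d (contract P w) - (-1 : ℝ) ^ a • contract P (d w)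

end Fields

/-! ### Facts on the exterior algebra, used to check the properties of the bracket below -/

section ExteriorAlgebraFacts

variable {E : Type*} [AddCommGroup E] [Module ℝ E]

theorem involute_of_mem (a : ℕ) (P : ExteriorAlgebra ℝ E)
    (hP : P ∈ ⋀[ℝ]^a E) : CliffordAlgebra.involute P = (-1 : ℝ) ^ a • P := by
  rw [ExteriorAlgebra.exteriorPower] at hP
  induction hP using Submodule.pow_induction_on_left' with
  | algebraMap r => simp
  | add x y i hx hy h1 h2 => simp [h1, h2]
  | mem_mul m hm i x hx h =>
    obtain ⟨u, rfl⟩ := hm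
    rw [map_mul, h]
    simp [ExteriorAlgebra.ι, pow_succ]

theorem contractLeft_mul_of_mem (δ : Module.Dual ℝ E) (a : ℕ) (P Q : ExteriorAlgebra ℝ E)
    (hP : P ∈ ⋀[ℝ]^a E) : CliffordAlgebra.contractLeft δ (P * Q) =
      CliffordAlgebra.contractLeft δ P * Q + (-1 : ℝ) ^ a • (P * CliffordAlgebra.contractLeft δ Q) := by
  rw [ExteriorAlgebra.exteriorPower] at hP
  induction hP using Submodule.pow_induction_on_left' generalizing Q with
  | algebraMap r => simp [CliffordAlgebra.contractLeft_algebraMap_mul, CliffordAlgebra.contractLeft_algebraMap]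
  | add x y i hx hy h1 h2 => simp only [add_mul, map_add, h1, h2, smul_add]; abel
  | mem_mul m hm i x hx h =>
    obtain ⟨u, rfl⟩ := hm
    simp only [ExteriorAlgebra.ι, mul_assoc, CliffordAlgebra.contractLeft_ι_mul, h, sub_mul, smul_mul_assoc, mul_add, pow_succ, mul_smul_comm]
    module

theorem ι_mul_comm_of_mem (b : ℕ) (u : E) (Q : ExteriorAlgebra ℝ E) (hQ : Q ∈ ⋀[ℝ]^b E) :
    ExteriorAlgebra.ι ℝ u * Q = (-1 : ℝ) ^ b • (Q * ExteriorAlgebra.ι ℝ u) := by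
  rw [ExteriorAlgebra.exteriorPower] at hQ
  induction hQ using Submodule.pow_induction_on_left' with
  | algebraMap r => simp [Algebra.commutes]
  | add x y i hx hy h1 h2 => simp [mul_add, add_mul, h1, h2]
  | mem_mul m hm i x hx h =>
    obtain ⟨w, rfl⟩ := hm
    have hsw := eq_neg_of_add_eq_zero_left (ExteriorAlgebra.ι_add_mul_swap (R := ℝ) u w)
    rw [← mul_assoc, hsw, neg_mul, mul_assoc, h]
    simp [pow_succ, mul_assoc]

theorem mul_comm_of_mem (a b : ℕ) (P Q : ExteriorAlgebra ℝ E)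
    (hP : P ∈ ⋀[ℝ]^a E) (hQ : Q ∈ ⋀[ℝ]^b E) : P * Q = (-1 : ℝ) ^ (a * b) • (Q * P) := by
  rw [ExteriorAlgebra.exteriorPower] at hP
  induction hP using Submodule.pow_induction_on_left' with
  | algebraMap r => simp [Algebra.commutes]
  | add x y i hx hy h1 h2 => simp [mul_add, add_mul, h1, h2]
  | mem_mul m hm i x hx h =>
    obtain ⟨w, rfl⟩ := hm
    rw [mul_assoc, h, mul_smul_comm, ← mul_assoc, ι_mul_comm_of_mem b w Q hQ, smul_mul_assoc, smul_smul, mul_assoc,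
      Nat.succ_mul, pow_add]

theorem contractLeft_mem0 (δ : Module.Dual ℝ E) (P : ExteriorAlgebra ℝ E)
    (hP : P ∈ ⋀[ℝ]^0 E) : CliffordAlgebra.contractLeft δ P = 0 := by
  simp only [ExteriorAlgebra.exteriorPower, pow_zero, Submodule.mem_one] at hP
  obtain ⟨r, rfl⟩ := hP
  exact CliffordAlgebra.contractLeft_algebraMap _ _ _

theorem contractLeft_mem_pred (δ : Module.Dual ℝ E) (a : ℕ) (P : ExteriorAlgebra ℝ E)
    (hP : P ∈ ⋀[ℝ]^a E) : CliffordAlgebra.contractLeft δ P ∈ ⋀[ℝ]^(a - 1) E := by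
  rw [ExteriorAlgebra.exteriorPower] at hP
  induction hP using Submodule.pow_induction_on_left' with
  | algebraMap r => simp [CliffordAlgebra.contractLeft_algebraMap]
  | add x y i hx hy h1 h2 => rw [map_add]; exact add_mem h1 h2
  | mem_mul m hm i x hx h =>
    obtain ⟨w, rfl⟩ := hm
    rw [ExteriorAlgebra.ι, CliffordAlgebra.contractLeft_ι_mul]
    refine sub_mem (Submodule.smul_mem _ _ hx) ?_
    cases i with
    | zero => rw [contractLeft_mem0 δ x hx, mul_zero]; exact zero_mem _
    | succ i =>
      change _ ∈ LinearMap.range (ExteriorAlgebra.ι ℝ) ^ (i + 1)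
      rw [pow_succ']
      exact Submodule.mul_mem_mul ⟨w, rfl⟩ h

theorem contractLeft_mem (δ : Module.Dual ℝ E) (a : ℕ) (P : ExteriorAlgebra ℝ E)
    (hP : P ∈ ⋀[ℝ]^(a + 1) E) : CliffordAlgebra.contractLeft δ P ∈ ⋀[ℝ]^a E :=
  contractLeft_mem_pred δ (a + 1) P hP

end ExteriorAlgebraFacts

/-! ### The Schouten bracket -/

section Schouten

variable {E : Type*} [NormedAddCommGroup E] [NormedSpace ℝ E] [FiniteDimensional ℝ E]
  {M : Type*} [TopologicalSpace M] [ChartedSpace E M]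

/-- Directional derivative at `y`, in the direction `v`, of a function with values in the exterior
algebra, computed in coordinates with respect to the basis of `⋀ E` given by a basis of `E`. -/
def dirDeriv (P : E → ExteriorAlgebra ℝ E) (y v : E) : ExteriorAlgebra ℝ E :=
  ∑ s, fderiv ℝ (fun z => (Module.finBasis ℝ E).ExteriorAlgebra.repr (P z) s) y v •
    (Module.finBasis ℝ E).ExteriorAlgebra s

/-- The bracket `nu` on the model space, in coordinates. With `∂ᵢ` the partial derivatives and
`eⁱ ⌟ -` the contraction with the `i`-th element of the dual basis (a graded derivation of degree
`-1`), it is, for `P` of degree `a`,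
`nu(P, Q) = ∑ᵢ (eⁱ ⌟ P) ∧ ∂ᵢ Q + (-1)^a ∂ᵢ P ∧ (eⁱ ⌟ Q)`.
The grading involution `involute` is multiplication by `(-1)^a` in degree `a`. -/
def nuModel (P Q : E → ExteriorAlgebra ℝ E) (y : E) : ExteriorAlgebra ℝ E :=
  ∑ i, (CliffordAlgebra.contractLeft ((Module.finBasis ℝ E).coord i) (P y) *
      dirDeriv Q y (Module.finBasis ℝ E i) +
    CliffordAlgebra.involute (dirDeriv P y (Module.finBasis ℝ E i)) *
      CliffordAlgebra.contractLeft ((Module.finBasis ℝ E).coord i) (Q y))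

/-! The following facts determine the bracket: it is graded symmetric, satisfies the Leibniz rule,
and has the right values on vector fields and functions. -/

theorem dirDeriv_comp {F : Type*} [NormedAddCommGroup F] [NormedSpace ℝ F] [FiniteDimensional ℝ F]
    (g : F →ₗ[ℝ] ExteriorAlgebra ℝ E) (V : E → F) (y v : E)
    (hV : DifferentiableAt ℝ V y) :
    dirDeriv (fun z => g (V z)) y v = g (fderiv ℝ V y v) := by
  unfold dirDeriv
  set B := (Module.finBasis ℝ E).ExteriorAlgebra
  have h : ∀ s, fderiv ℝ (fun z => B.repr (g (V z)) s) y v = B.repr (g (fderiv ℝ V y v)) s := by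
    intro s
    let L : F →L[ℝ] ℝ := LinearMap.toContinuousLinearMap (B.coord s ∘ₗ g)
    have : fderiv ℝ (fun z => L (V z)) y v = L (fderiv ℝ V y v) := by
      have := (L.hasFDerivAt.comp y hV.hasFDerivAt).fderiv
      have h2 := congrArg (fun T => T v) this
      simpa [Function.comp_def] using h2
    simpa [L] using this
  simp_rw [h]
  exact B.sum_repr _

/-- The directional derivative satisfies the product rule. -/
theorem dirDeriv_mul (P Q : E → ExteriorAlgebra ℝ E) (y v : E)
    (hP : ∀ φ : Module.Dual ℝ (ExteriorAlgebra ℝ E), DifferentiableAt ℝ (fun z => φ (P z)) y)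
    (hQ : ∀ φ : Module.Dual ℝ (ExteriorAlgebra ℝ E), DifferentiableAt ℝ (fun z => φ (Q z)) y) :
    dirDeriv (fun z => P z * Q z) y v = dirDeriv P y v * Q y + P y * dirDeriv Q y v := by
  set B := (Module.finBasis ℝ E).ExteriorAlgebra with hB
  have hP' : ∀ s, DifferentiableAt ℝ (fun z => B.repr (P z) s) y := fun s => hP (B.coord s)
  have hQ' : ∀ s, DifferentiableAt ℝ (fun z => B.repr (Q z) s) y := fun s => hQ (B.coord s)
  have key : ∀ s, fderiv ℝ (fun z => B.repr (P z * Q z) s) y v =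
      B.repr (dirDeriv P y v * Q y + P y * dirDeriv Q y v) s := by
    intro s
    have e : (fun z => B.repr (P z * Q z) s) = fun z => ∑ t, ∑ u,
        (B.repr (P z) t * B.repr (Q z) u) * B.repr (B t * B u) s := by
      funext z
      conv_lhs => rw [← B.sum_repr (P z), ← B.sum_repr (Q z), Finset.sum_mul_sum]
      simp only [smul_mul_smul_comm, map_sum, map_smul, Finsupp.coe_finsetSum, Finset.sum_apply, Finsupp.smul_apply, smul_eq_mul]
    have e2 : ∀ t u, HasFDerivAt (fun z => (B.repr (P z) t * B.repr (Q z) u) * B.repr (B t * B u) s)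
      (B.repr (B t * B u) s • (B.repr (P y) t • fderiv ℝ (fun z => B.repr (Q z) u) y
        + B.repr (Q y) u • fderiv ℝ (fun z => B.repr (P z) t) y)) y := fun t u =>
      ((hP' t).hasFDerivAt.mul (hQ' u).hasFDerivAt).mul_const _
    have e3 := HasFDerivAt.fun_sum (u := Finset.univ) fun t _ =>
      HasFDerivAt.fun_sum (u := Finset.univ) fun u _ => e2 t u
    rw [e, e3.fderiv]
    have c : dirDeriv P y v * Q y + P y * dirDeriv Q y v = ∑ t, ∑ u,
        (fderiv ℝ (fun z => B.repr (P z) t) y v * B.repr (Q y) u +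
          B.repr (P y) t * fderiv ℝ (fun z => B.repr (Q z) u) y v) • (B t * B u) := by
      conv_lhs => rw [← B.sum_repr (P y), ← B.sum_repr (Q y)]
      unfold dirDeriv
      rw [← hB, Finset.sum_mul_sum, Finset.sum_mul_sum, ← Finset.sum_add_distrib]
      refine Finset.sum_congr rfl fun t _ => ?_
      rw [← Finset.sum_add_distrib]
      refine Finset.sum_congr rfl fun u _ => ?_
      rw [smul_mul_smul_comm, smul_mul_smul_comm, ← add_smul]
    rw [c]
    simp
    refine Finset.sum_congr rfl fun t _ => Finset.sum_congr rfl fun u _ => by ring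
  unfold dirDeriv
  rw [← hB]
  simp_rw [key]
  rw [B.sum_repr]
  rfl

theorem dirDeriv_mem (a : ℕ) (P : E → ExteriorAlgebra ℝ E) (y v : E)
    (hP : ∀ z, P z ∈ ⋀[ℝ]^a E) : dirDeriv P y v ∈ ⋀[ℝ]^a E := by
  set b := Module.finBasis ℝ E with hb
  refine Submodule.sum_mem _ fun s _ => ?_
  by_cases hs : s.card = a
  · refine Submodule.smul_mem _ _ ?_
    subst hs
    have h := ExteriorAlgebra.basis_eq_coe_basis b (⟨s, rfl⟩ : Set.powersetCard _ s.card)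
    change b.ExteriorAlgebra s = _ at h
    rw [← hb, h]
    exact Subtype.property _
  · have h0 : (fun z => b.ExteriorAlgebra.repr (P z) s) = fun _ => 0 := by
      funext z
      have e := (b.exteriorPower a).sum_repr ⟨P z, hP z⟩
      have e' : P z = ∑ t, (b.exteriorPower a).repr ⟨P z, hP z⟩ t • b.ExteriorAlgebra t := by
        conv_lhs => rw [show P z = ((⟨P z, hP z⟩ : ⋀[ℝ]^a E) : ExteriorAlgebra ℝ E) from rfl, ← e]
        simp [ExteriorAlgebra.basis_eq_coe_basis]
      rw [e', map_sum, Finsupp.coe_finsetSum, Finset.sum_apply]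
      refine Finset.sum_eq_zero fun t _ => ?_
      have : (t : Finset _) ≠ s := fun h => hs (h ▸ t.2)
      simp [this]
    rw [← hb, h0]
    simp

/-- `nu` is the Lie bracket on vector fields. -/
theorem nuModel_vec (V W : E → E) (y : E) (hV : DifferentiableAt ℝ V y)
    (hW : DifferentiableAt ℝ W y) :
    nuModel (fun z => ExteriorAlgebra.ι ℝ (V z)) (fun z => ExteriorAlgebra.ι ℝ (W z)) y =
      ExteriorAlgebra.ι ℝ (VectorField.lieBracket ℝ V W y) := by
  unfold nuModel
  simp_rw [dirDeriv_comp _ _ _ _ hV, dirDeriv_comp _ _ _ _ hW]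
  simp only [ExteriorAlgebra.ι, CliffordAlgebra.contractLeft_ι, CliffordAlgebra.involute_ι]
  have h1 : ∀ (f : E →L[ℝ] E) (u : E), f u = ∑ i, (Module.finBasis ℝ E).repr u i • f (Module.finBasis ℝ E i) := by
    intro f u
    conv_lhs => rw [← (Module.finBasis ℝ E).sum_repr u, map_sum]
    simp only [map_smul]
  rw [VectorField.lieBracket, h1 _ (V y), h1 _ (W y), map_sub, map_sum, map_sum, ← Finset.sum_sub_distrib]
  refine Finset.sum_congr rfl fun i _ => ?_
  rw [← Algebra.smul_def, ← Algebra.commutes, ← Algebra.smul_def]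
  simp [sub_eq_add_neg]

/-- `nu(V, f) = V f` for a vector field and a function. -/
theorem nuModel_fun (V : E → E) (f : E → ℝ) (y : E) (hV : DifferentiableAt ℝ V y)
    (hf : DifferentiableAt ℝ f y) :
    nuModel (fun z => ExteriorAlgebra.ι ℝ (V z)) (fun z => algebraMap ℝ _ (f z)) y =
      algebraMap ℝ _ (fderiv ℝ f y (V y)) := by
  have := fun v => dirDeriv_comp (Algebra.linearMap ℝ (ExteriorAlgebra ℝ E)) f y v hf
  simp only [Algebra.linearMap_apply] at this
  unfold nuModel
  simp_rw [dirDeriv_comp _ _ _ _ hV, this]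
  simp only [ExteriorAlgebra.ι, CliffordAlgebra.contractLeft_ι, CliffordAlgebra.contractLeft_algebraMap]
  conv_rhs => rw [← (Module.finBasis ℝ E).sum_repr (V y), map_sum, map_sum]
  refine Finset.sum_congr rfl fun i _ => ?_
  rw [mul_zero, add_zero, map_smul, smul_eq_mul, map_mul]
  rfl

/-- The Leibniz rule: `nu(P, -)` is a derivation of degree `a - 1` for `P` of degree `a`. -/
theorem nuModel_mul (a b : ℕ) (P Q R : E → ExteriorAlgebra ℝ E) (y : E)
    (hP : ∀ z, P z ∈ ⋀[ℝ]^a E) (hQ : ∀ z, Q z ∈ ⋀[ℝ]^b E)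
    (hQ' : ∀ φ : Module.Dual ℝ (ExteriorAlgebra ℝ E), DifferentiableAt ℝ (fun z => φ (Q z)) y)
    (hR' : ∀ φ : Module.Dual ℝ (ExteriorAlgebra ℝ E), DifferentiableAt ℝ (fun z => φ (R z)) y) :
    nuModel P (fun z => Q z * R z) y =
      nuModel P Q y * R y + (-1 : ℝ) ^ ((a + 1) * b) • (Q y * nuModel P R y) := by
  unfold nuModel
  simp_rw [Finset.sum_mul, Finset.mul_sum, Finset.smul_sum, ← Finset.sum_add_distrib]
  refine Finset.sum_congr rfl fun i _ => ?_
  rw [dirDeriv_mul _ _ _ _ hQ' hR', contractLeft_mul_of_mem _ b _ _ (hQ y),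
    involute_of_mem a _ (dirDeriv_mem a P y _ hP)]
  set δ := (Module.finBasis ℝ E).coord i
  set v := Module.finBasis ℝ E i
  have h1 : CliffordAlgebra.contractLeft δ (P y) * (Q y) = (-1 : ℝ) ^ ((a + 1) * b) • (Q y * CliffordAlgebra.contractLeft δ (P y)) := by
    cases a with
    | zero => simp [contractLeft_mem0 δ _ (hP y)]
    | succ a =>
      rw [mul_comm_of_mem _ _ _ _ (contractLeft_mem δ a _ (hP y)) (hQ y)]
      congr 1
      rw [show (a + 1 + 1) * b = a * b + 2 * b by ring, pow_add]; simp
  have h2 := mul_comm_of_mem _ _ _ _ (dirDeriv_mem a P y v hP) (hQ y)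
  have h3 : (-1 : ℝ) ^ ((a + 1) * b) = (-1) ^ b * (-1) ^ (a * b) := by ring
  simp only [mul_add, add_mul, smul_add, mul_smul_comm, smul_mul_assoc, ← mul_assoc, h1, h2]
  module

/-- `nu` is graded symmetric. -/
theorem nuModel_symm (a b : ℕ) (P Q : E → ExteriorAlgebra ℝ E) (y : E)
    (hP : ∀ z, P z ∈ ⋀[ℝ]^a E) (hQ : ∀ z, Q z ∈ ⋀[ℝ]^b E) :
    nuModel P Q y = (-1 : ℝ) ^ (a * b) • nuModel Q P y := by
  unfold nuModel
  rw [Finset.smul_sum]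
  refine Finset.sum_congr rfl fun i _ => ?_
  rw [involute_of_mem a _ (dirDeriv_mem a P y _ hP), involute_of_mem b _ (dirDeriv_mem b Q y _ hQ)]
  set δ := (Module.finBasis ℝ E).coord i
  set v := Module.finBasis ℝ E i
  have h1 : ∀ (a b : ℕ) (P Q : E → ExteriorAlgebra ℝ E) (hP : ∀ z, P z ∈ ⋀[ℝ]^a E) (hQ : ∀ z, Q z ∈ ⋀[ℝ]^b E),
      CliffordAlgebra.contractLeft δ (P y) * dirDeriv Q y v =
      (-1 : ℝ) ^ ((a + 1) * b) • (dirDeriv Q y v * CliffordAlgebra.contractLeft δ (P y)) := by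
    intro a b P Q hP hQ
    cases a with
    | zero => simp [contractLeft_mem0 δ _ (hP y)]
    | succ a =>
      rw [mul_comm_of_mem _ _ _ _ (contractLeft_mem δ a _ (hP y)) (dirDeriv_mem b Q y v hQ)]
      congr 1
      rw [show (a + 1 + 1) * b = a * b + 2 * b by ring, pow_add]; simp
  rw [h1 a b P Q hP hQ, h1 b a Q P hQ hP]
  have e1 : (-1 : ℝ) ^ ((a + 1) * b) = (-1) ^ b * (-1) ^ (a * b) := by ring
  have e2 : (-1 : ℝ) ^ ((b + 1) * a) = (-1) ^ a * (-1) ^ (a * b) := by ring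
  have e3 : (-1 : ℝ) ^ (a * b) * (-1) ^ (a * b) = 1 := by rw [← mul_pow]; simp
  rw [e1, e2]
  simp only [smul_mul_assoc, smul_add, smul_smul]
  rw [show (-1 : ℝ) ^ (a * b) * ((-1) ^ a * (-1) ^ (a * b)) = (-1) ^ a by rw [mul_left_comm, e3, mul_one]]
  rw [add_comm]
  congr 2
  ring

/-- The decalage `nu(x, y) = (-1)^(|x| - 1) [x, y]` of the Schouten bracket `[x, y]` on multivector
fields: the graded symmetric bracket of degree `-1` such that `nu(x, -)` is a derivation of degree
`|x| - 1` of the wedge product, which is the Lie bracket on vector fields and the directional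
derivative `nu(X, f) = X f` on a vector field and a function. On decomposable multivector fields,
`[x₁ ⋯ xₙ, y₁ ⋯ yₘ] = ∑ᵢⱼ (-1)^(i + j) [xᵢ, yⱼ] x₁ ⋯ x̂ᵢ ⋯ xₙ y₁ ⋯ ŷⱼ ⋯ yₘ`.
At a point `p` it is computed in the preferred chart at `p`. -/
def nu (P Q : MvField E M) : MvField E M := fun p =>
  MvField.pullback (extChartAt 𝓘(ℝ, E) p)
    (nuModel (MvField.pullback (extChartAt 𝓘(ℝ, E) p).symm P)
      (MvField.pullback (extChartAt 𝓘(ℝ, E) p).symm Q)) p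

/-- On vector fields, `nu` is the Lie bracket of vector fields of Mathlib. -/
theorem nu_vec
    (V W : (p : M) → TangentSpace 𝓘(ℝ, E) p) (p : M)
    (hV : DifferentiableAt ℝ (VectorField.mpullback 𝓘(ℝ, E) 𝓘(ℝ, E) (extChartAt 𝓘(ℝ, E) p).symm V) (extChartAt 𝓘(ℝ, E) p p))
    (hW : DifferentiableAt ℝ (VectorField.mpullback 𝓘(ℝ, E) 𝓘(ℝ, E) (extChartAt 𝓘(ℝ, E) p).symm W) (extChartAt 𝓘(ℝ, E) p p)) :
   nu (fun q => ExteriorAlgebra.ι ℝ (V q)) (fun q => ExteriorAlgebra.ι ℝ (W q)) p =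
     ExteriorAlgebra.ι ℝ (VectorField.mlieBracket 𝓘(ℝ, E) V W p) := by
  have key : ∀ V : (p : M) → TangentSpace 𝓘(ℝ, E) p,
     MvField.pullback (extChartAt 𝓘(ℝ, E) p).symm (fun q => ExteriorAlgebra.ι ℝ (V q)) =
       fun z => ExteriorAlgebra.ι ℝ (VectorField.mpullback 𝓘(ℝ, E) 𝓘(ℝ, E) (extChartAt 𝓘(ℝ, E) p).symm V z) := by
    intro V; funext z
    exact ExteriorAlgebra.map_apply_ι _ _
  unfold nu
  rw [key, key]
  have h : ∀ (V W : E → E) (y : E), DifferentiableAt ℝ V y → DifferentiableAt ℝ W y →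
      nuModel (fun z => ExteriorAlgebra.ι ℝ (V z)) (fun z => ExteriorAlgebra.ι ℝ (W z)) y =
      ExteriorAlgebra.ι ℝ (VectorField.lieBracketWithin ℝ V W Set.univ y) := fun V W y hV hW => by
    rw [VectorField.lieBracketWithin_univ, nuModel_vec _ _ _ hV hW]
  have := congrArg (ExteriorAlgebra.map ((mfderiv 𝓘(ℝ, E) 𝓘(ℝ, E) (extChartAt 𝓘(ℝ, E) p) p).inverse :
    TangentSpace 𝓘(ℝ, E) (extChartAt 𝓘(ℝ, E) p p) →ₗ[ℝ] TangentSpace 𝓘(ℝ, E) p)) (h _ _ _ hV hW)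
  refine Eq.trans this ?_
  refine (ExteriorAlgebra.map_apply_ι _ _).trans ?_
  rw [VectorField.mlieBracket, VectorField.mlieBracketWithin_apply]
  simp only [modelWithCornersSelf_coe, Set.range_id, Set.preimage_univ, Set.inter_univ,
    VectorField.mpullbackWithin_univ]
  rfl

end Schouten

/-! ### Unshuffles, Koszul signs and the higher brackets -/

section Combinatorics

/-- The `(p, n - p)`-unshuffles: the permutations that are increasing on the first `p` indices
and on the last `n - p` indices. -/
def unshuffles (p n : ℕ) : Finset (Equiv.Perm (Fin n)) :=
  {σ | ∀ i j : Fin n, i < j → (j.val < p ∨ p ≤ i.val) → σ i < σ j}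

/-- The Koszul sign `ε` of the permutation `σ` on elements `x₁, …, xₙ` of degrees `a₁, …, aₙ`, where
`x₁ ⊗ ⋯ ⊗ xₙ` is identified with `ε x_{σ(1)} ⊗ ⋯ ⊗ x_{σ(n)}`: every pair of elements whose order is
changed contributes the sign `(-1)` to the product of the degrees. -/
def koszulSign {n : ℕ} (a : Fin n → ℕ) (σ : Equiv.Perm (Fin n)) : ℝ :=
  ∏ q : Fin n × Fin n with q.1 < q.2 ∧ σ q.2 < σ q.1, (-1 : ℝ) ^ (a (σ q.1) * a (σ q.2))

variable {E : Type*} [NormedAddCommGroup E] [NormedSpace ℝ E] [FiniteDimensional ℝ E]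
  {M : Type*} [TopologicalSpace M] [ChartedSpace E M]

/-- The brackets `nu_n` on fields of multivectors `x₁, …, xₙ` of degrees `a₁, …, aₙ`: `nu₁ = 0` and
`nu_n(x₁, …, xₙ) = ∑_σ ε(σ) nu(x_{σ(1)}, x_{σ(2)}) x_{σ(3)} ⋯ x_{σ(n)}`
over the `(2, n - 2)`-unshuffles for `n ≥ 2`, so that `nu₂ = nu`. (The value for `n = 0` is
irrelevant.) -/
def higherNu : (n : ℕ) → (Fin n → ℕ) → (Fin n → MvField E M) → MvField E M
  | 0, _, _ => 0
  | 1, _, _ => 0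
  | n + 2, a, x => ∑ σ ∈ unshuffles 2 (n + 2), koszulSign a σ •
      (nu (x (σ 0)) (x (σ 1)) * (List.ofFn fun i : Fin n => x (σ i.succ.succ)).prod)

end Combinatorics

end Multisymplectic

end

noncomputable section

namespace Multisymplectic

/-! ### Exterior multiplication by a covector -/

section ExteriorMultiplication

variable {E F : Type*} [NormedAddCommGroup E] [NormedSpace ℝ E]
  [NormedAddCommGroup F] [NormedSpace ℝ F]

/-! Everything rests on the case of two factors. For `P` of degree `a` and `Q` of degree `b`,
`L_{PQ} = ι_{nu(P,Q)} + (-1)^((a+1)b) ι_Q L_P + (-1)^a ι_P L_Q` (`lieModel_mul`). On the model space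
write `d = ∑ᵢ eⁱ ∧ ∂ᵢ` (`extDerivAt_eq_sum`) and combine the product rule `∂ᵢ(ι_P w) = ι_{∂ᵢP} w +
ι_P ∂ᵢw` with the commutation rule `eⁱ ∧ ι_P = ι_{eⁱ⌟P} + (-1)^a ι_P (eⁱ ∧ -)`. The terms `ι_P (eⁱ ∧
∂ᵢw)` drop out of the graded commutator, leaving `L_P w = ∑ᵢ eⁱ ∧ ι_{∂ᵢP} w + ι_{eⁱ⌟P} ∂ᵢw`
(`lieModel_eq_sum`). Substituting a product for `P` and commuting `eⁱ ∧ -` past the outer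
contraction produces exactly the coordinate formula for `nu`.

For more factors, split off the first one and induct (`lieModel_list_prod`). The bracket terms then
accumulate as `nu(x₀, x₁⋯xₙ) + (-1)^|x₀| x₀ · (bracket of the rest)`. By the Leibniz rule this is a
signed sum over pairs of positions (`nuRec_eq_sum`). A `(2, n-2)`-unshuffle is such a pair, and an
`(n-1, 1)`-unshuffle is a choice of the last element; their Koszul signs count the degrees jumped
over when the chosen elements are moved to the front or to the end.

On a manifold, `d` and `nu` at `p` are computed in the preferred chart at `p`, whose derivative at
`p` is the identity, so the identity at `p` is the one on the model space at the image of `p`. For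
closed `ω` every Lie derivative is `d ι`, which gives (b); in the multisymplectic case the
right-hand side vanishes. -/

/-- Exterior multiplication `α ↦ φ ∧ α` by a covector `φ`. -/
def extMul (φ : E →L[ℝ] ℝ) : Module.End ℝ (AltForms E) where
  toFun α k := match k with
    | 0 => 0
    | k + 1 => ContinuousAlternatingMap.alternatizeUncurryFin (φ.smulRight (α k))
  map_add' α β := by
    funext k
    cases k with
    | zero => simp
    | succ k =>
      ext v
      simp [ContinuousAlternatingMap.alternatizeUncurryFin_apply, Finset.sum_add_distrib]
  map_smul' c α := by
    funext k
    cases k with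
    | zero => simp
    | succ k =>
      ext v
      simp only [ContinuousAlternatingMap.alternatizeUncurryFin_apply, Pi.smul_apply,
        ContinuousLinearMap.smulRight_apply, ContinuousAlternatingMap.smul_apply, RingHom.id_apply,
        smul_eq_mul, zsmul_eq_mul, Finset.mul_sum]
      exact Finset.sum_congr rfl fun i _ => by ring

theorem extMul_zero_apply (φ : E →L[ℝ] ℝ) (α : AltForms E) : extMul φ α 0 = 0 := rfl

theorem extMul_succ_apply (φ : E →L[ℝ] ℝ) (α : AltForms E) (k : ℕ) :
    extMul φ α (k + 1) =
      ContinuousAlternatingMap.alternatizeUncurryFin (φ.smulRight (α k)) := rfl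

theorem contractMultivector_ι (v : E) :
    contractMultivector E (ExteriorAlgebra.ι ℝ v) = contractVec E v := by
  simp [contractMultivector]

/-- In the alternating sum for `φ ∧ α` evaluated on `(v, u)`, the term in which `φ` eats `v` is
`φ(v) α(u)`. The other terms are those of `φ ∧ ι_v α` with one extra sign. -/
theorem extMul_mul_contractVec (φ : E →L[ℝ] ℝ) (v : E) :
    extMul φ * contractVec E v = φ v • 1 - contractVec E v * extMul φ := by
  refine LinearMap.ext fun α => funext fun k => ?_
  change extMul φ (contractVec E v α) k = φ v • α k - (extMul φ α (k + 1)).curryLeft v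
  rw [extMul_succ_apply]
  ext u
  cases k with
  | zero =>
    simp [extMul_zero_apply, ContinuousAlternatingMap.alternatizeUncurryFin_apply]
  | succ k =>
    rw [extMul_succ_apply]
    simp only [ContinuousAlternatingMap.alternatizeUncurryFin_apply,
      ContinuousAlternatingMap.sub_apply, ContinuousAlternatingMap.smul_apply,
      ContinuousAlternatingMap.curryLeft_apply_apply, ContinuousLinearMap.smulRight_apply]
    rw [Fin.sum_univ_succ (n := k + 1)]
    simp only [Fin.val_zero, pow_zero, one_smul, Fin.val_succ, Matrix.cons_val_zero,
      Matrix.cons_val_succ]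
    have h1 : (0 : Fin (k + 2)).removeNth (Matrix.vecCons v u) = u :=
      Fin.removeNth_zero _
    have h2 : ∀ i : Fin (k + 1), i.succ.removeNth (Matrix.vecCons v u) =
        Matrix.vecCons v (i.removeNth u) := by
      intro i
      funext j
      cases j using Fin.cases <;> simp [Fin.removeNth, Matrix.vecCons]
    simp only [h1, h2, pow_succ]
    rw [← sub_sub, sub_self, zero_sub, ← Finset.sum_neg_distrib]
    refine Finset.sum_congr rfl fun i _ => ?_
    have h3 : contractVec E v α k (i.removeNth u) =
      α (k + 1) (Matrix.vecCons v (i.removeNth u)) := rfl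
    simp [h3]

theorem exteriorAlgebra_left_induction {C : ExteriorAlgebra ℝ E → Prop}
    (algebraMap : ∀ r : ℝ, C (algebraMap ℝ _ r)) (add : ∀ P Q, C P → C Q → C (P + Q))
    (ι_mul : ∀ P v, C P → C (ExteriorAlgebra.ι ℝ v * P)) (P : ExteriorAlgebra ℝ E) : C P :=
  CliffordAlgebra.left_induction (Q := 0) algebraMap add ι_mul P

/-- The commutator of exterior multiplication by a covector and contraction by a multivector. -/
theorem extMul_mul_contractMultivector (φ : E →L[ℝ] ℝ) (P : ExteriorAlgebra ℝ E) :
    extMul φ * contractMultivector E P =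
      contractMultivector E (CliffordAlgebra.contractLeft (φ : Module.Dual ℝ E) P) +
        contractMultivector E (CliffordAlgebra.involute P) * extMul φ := by
  induction P using exteriorAlgebra_left_induction with
  | algebraMap r =>
    rw [CliffordAlgebra.contractLeft_algebraMap, AlgHom.commutes, AlgHom.commutes, AlgHom.commutes,
      map_zero, zero_add, Algebra.commutes]
  | add P Q hP hQ =>
    have e : CliffordAlgebra.involute (P + Q) =
      (CliffordAlgebra.involute P + CliffordAlgebra.involute Q : ExteriorAlgebra ℝ E) :=
      map_add _ _ _
    rw [e]
    simp only [map_add, add_mul, hP, hQ, mul_add]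
    abel
  | ι_mul P v hP =>
    have e1 : CliffordAlgebra.involute (ExteriorAlgebra.ι ℝ v * P) =
        (-(ExteriorAlgebra.ι ℝ v * CliffordAlgebra.involute P) : ExteriorAlgebra ℝ E) := by
      rw [map_mul, ExteriorAlgebra.ι, CliffordAlgebra.involute_ι, neg_mul]
    have e2 : CliffordAlgebra.contractLeft (φ : Module.Dual ℝ E) (ExteriorAlgebra.ι ℝ v * P) =
        (φ v • P - ExteriorAlgebra.ι ℝ v *
          CliffordAlgebra.contractLeft (φ : Module.Dual ℝ E) P : ExteriorAlgebra ℝ E) :=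
      CliffordAlgebra.contractLeft_ι_mul _ _ _
    rw [e1, e2, map_mul, map_sub, map_smul, map_neg, map_mul, map_mul, contractMultivector_ι,
      ← mul_assoc, extMul_mul_contractVec]
    -- Moving `φ ∧ -` past `ι_v` leaves `-ι_v (φ ∧ ι_P α)`, so the induction hypothesis is needed
    -- with `ι_v` applied to it.
    refine LinearMap.ext fun α => ?_
    have h := congrArg (contractVec E v) (LinearMap.congr_fun hP α)
    simp only [Module.End.mul_apply, LinearMap.add_apply, LinearMap.sub_apply,
      LinearMap.smul_apply, LinearMap.neg_apply, Module.End.one_apply, map_add] at h ⊢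
    rw [h]
    abel

theorem extMul_contractMultivector_of_mem (φ : E →L[ℝ] ℝ) (a : ℕ) (P : ExteriorAlgebra ℝ E)
    (hP : P ∈ ⋀[ℝ]^a E) (α : AltForms E) :
    extMul φ (contractMultivector E P α) =
      contractMultivector E (CliffordAlgebra.contractLeft (φ : Module.Dual ℝ E) P) α +
        (-1 : ℝ) ^ a • contractMultivector E P (extMul φ α) := by
  have h := LinearMap.congr_fun (extMul_mul_contractMultivector φ P) α
  have e : CliffordAlgebra.involute P = ((-1 : ℝ) ^ a • P : ExteriorAlgebra ℝ E) :=
    involute_of_mem a P hP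
  rwa [e, map_smul] at h

/-! ### Naturality of the contraction -/

/-- Pullback of alternating forms of all degrees under a continuous linear map. -/
def AltForms.comp (A : E →L[ℝ] F) : AltForms F →ₗ[ℝ] AltForms E where
  toFun α k := (α k).compContinuousLinearMap A
  map_add' _ _ := rfl
  map_smul' _ _ := rfl

/-- Both sides are compatible with sums and products in `P`, so it suffices to check a single
vector. The multivector is pushed forward and the form pulled back, so applying this to a pulled
back multivector needs `A` invertible. -/
theorem AltForms.comp_contractMultivector (A : E →L[ℝ] F) (P : ExteriorAlgebra ℝ E)
    (α : AltForms F) :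
    AltForms.comp A (contractMultivector F (ExteriorAlgebra.map (A : E →ₗ[ℝ] F) P) α) =
      contractMultivector E P (AltForms.comp A α) := by
  induction P using ExteriorAlgebra.induction generalizing α with
  | algebraMap r => simp only [AlgHom.commutes, Module.algebraMap_end_apply, map_smul]
  | ι v =>
    rw [ExteriorAlgebra.map_apply_ι, contractMultivector_ι, contractMultivector_ι]
    funext k
    ext u
    change α (k + 1) (Matrix.vecCons (A v) (A ∘ u)) = α (k + 1) (A ∘ Matrix.vecCons v u)
    congr 1
    funext j
    cases j using Fin.cases <;> rfl
  | mul P Q hP hQ =>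
    rw [map_mul, map_mul, map_mul, Module.End.mul_apply, Module.End.mul_apply, hP, hQ]
  | add P Q hP hQ => simp only [map_add, LinearMap.add_apply, hP, hQ]

end ExteriorMultiplication

/-! ### The Lie derivative on the model space -/

section Model

variable {E : Type*} [NormedAddCommGroup E] [NormedSpace ℝ E]

/-- Componentwise directional derivative of a field of forms. -/
def formDeriv (w : E → AltForms E) (y v : E) : AltForms E := fun k =>
  fderiv ℝ (fun z => w z k) y v

/-- Contraction by a constant multivector is composed of continuous linear maps, hence commutes with
differentiation. Derivatives are taken degree by degree; the family `D'` is existential because each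
vector factor shifts the degree. -/
theorem hasFDerivAt_contractMultivector_const (B : ExteriorAlgebra ℝ E) (w : E → AltForms E)
    (y : E) (D : (k : ℕ) → E →L[ℝ] E [⋀^Fin k]→L[ℝ] ℝ)
    (hw : ∀ k, HasFDerivAt (fun z => w z k) (D k) y) :
    ∃ D' : (k : ℕ) → E →L[ℝ] E [⋀^Fin k]→L[ℝ] ℝ,
      (∀ k, HasFDerivAt (fun z => contractMultivector E B (w z) k) (D' k) y) ∧
      ∀ v, (fun k => D' k v) = contractMultivector E B (fun k => D k v) := by
  induction B using ExteriorAlgebra.induction generalizing w D with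
  | algebraMap r =>
    refine ⟨fun k => r • D k, fun k => ?_, fun v => ?_⟩
    · simp only [AlgHom.commutes, Module.algebraMap_end_apply]
      exact (hw k).const_smul r
    · simp only [AlgHom.commutes, Module.algebraMap_end_apply]
      rfl
  | ι u =>
    let L : (k : ℕ) → E [⋀^Fin (k + 1)]→L[ℝ] ℝ →L[ℝ] E [⋀^Fin k]→L[ℝ] ℝ := fun k =>
      (ContinuousLinearMap.apply ℝ _ u).comp
        (ContinuousAlternatingMap.curryLeftLI (𝕜 := ℝ) (E := E) (F := ℝ) (n := k)).toContinuousLinearMap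
    refine ⟨fun k => (L k).comp (D (k + 1)), fun k => ?_, fun v => ?_⟩
    · rw [contractMultivector_ι]
      exact (L k).hasFDerivAt.comp y (hw (k + 1))
    · rw [contractMultivector_ι]
      rfl
  | mul A B hA hB =>
    obtain ⟨D₁, h₁, e₁⟩ := hB w D hw
    obtain ⟨D₂, h₂, e₂⟩ := hA _ D₁ h₁
    refine ⟨D₂, fun k => ?_, fun v => ?_⟩
    · simpa only [map_mul, Module.End.mul_apply] using h₂ k
    · rw [e₂, e₁, map_mul, Module.End.mul_apply]
  | add A B hA hB =>
    obtain ⟨D₁, h₁, e₁⟩ := hA w D hw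
    obtain ⟨D₂, h₂, e₂⟩ := hB w D hw
    refine ⟨fun k => D₁ k + D₂ k, fun k => ?_, fun v => ?_⟩
    · simp only [map_add]
      exact (h₁ k).add (h₂ k)
    · rw [map_add, LinearMap.add_apply, ← e₁, ← e₂]
      rfl

/-- The contracted factor has degree `a - 1`. The exponent uses `a + 1`, of the same parity, to
avoid truncated subtraction; for `a = 0` both sides vanish. -/
theorem contractLeft_mul_comm (δ : Module.Dual ℝ E) {a b : ℕ} {P Q : ExteriorAlgebra ℝ E}
    (hP : P ∈ ⋀[ℝ]^a E) (hQ : Q ∈ ⋀[ℝ]^b E) :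
    CliffordAlgebra.contractLeft δ P * Q =
      (-1 : ℝ) ^ ((a + 1) * b) • (Q * CliffordAlgebra.contractLeft δ P) := by
  cases a with
  | zero => simp [contractLeft_mem0 δ _ hP]
  | succ a =>
    rw [mul_comm_of_mem _ _ _ _ (contractLeft_mem δ a _ hP) hQ]
    congr 1
    rw [show (a + 1 + 1) * b = a * b + 2 * b by ring, pow_add]
    simp

variable [FiniteDimensional ℝ E]

/-- The product rule for the contraction. -/
theorem formDeriv_contractMultivector (P : E → ExteriorAlgebra ℝ E) (w : E → AltForms E) (y v : E)
    (hP : ∀ φ : Module.Dual ℝ (ExteriorAlgebra ℝ E), DifferentiableAt ℝ (fun z => φ (P z)) y)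
    (hw : ∀ k, DifferentiableAt ℝ (fun z => w z k) y) :
    formDeriv (fun z => contractMultivector E (P z) (w z)) y v =
      contractMultivector E (dirDeriv P y v) (w y) +
        contractMultivector E (P y) (formDeriv w y v) := by
  -- In a basis of `⋀ E`, `ι_P w` is a finite sum of scalar functions times contractions by constant
  -- multivectors, so the scalar product rule applies.
  set B := (Module.finBasis ℝ E).ExteriorAlgebra with hB
  choose D' h' e' using fun s => hasFDerivAt_contractMultivector_const (B s) w y _
    fun k => (hw k).hasFDerivAt
  have hc : ∀ s, DifferentiableAt ℝ (fun z => B.repr (P z) s) y := fun s => hP (B.coord s)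
  have ew : ∀ Q α, contractMultivector E Q α =
      ∑ s, B.repr Q s • contractMultivector E (B s) α := by
    intro Q α
    conv_lhs => rw [← B.sum_repr Q]
    rw [map_sum, LinearMap.sum_apply]
    simp only [map_smul, LinearMap.smul_apply]
  have hd : ∀ k, HasFDerivAt (fun z => contractMultivector E (P z) (w z) k)
      (∑ s, (B.repr (P y) s • D' s k +
        (fderiv ℝ (fun z => B.repr (P z) s) y).smulRight (contractMultivector E (B s) (w y) k)))
      y := by
    intro k
    have e : (fun z => contractMultivector E (P z) (w z) k) =
        fun z => ∑ s, B.repr (P z) s • contractMultivector E (B s) (w z) k := by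
      funext z
      rw [ew, Finset.sum_apply]
      rfl
    rw [e]
    exact HasFDerivAt.fun_sum fun s _ => (hc s).hasFDerivAt.smul (h' s k)
  funext k
  have e1 : formDeriv (fun z => contractMultivector E (P z) (w z)) y v k = _ :=
    congrArg (fun T => T v) (hd k).fderiv
  have e2 : dirDeriv P y v = ∑ s, fderiv ℝ (fun z => B.repr (P z) s) y v • B s := rfl
  have e3 : ∀ s, contractMultivector E (B s) (formDeriv w y v) k = D' s k v := fun s =>
    (congrFun (e' s v) k).symm
  rw [e1, e2, map_sum, LinearMap.sum_apply, Pi.add_apply, Finset.sum_apply, ew (P y),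
    Finset.sum_apply, sum_apply, ← Finset.sum_add_distrib]
  refine Finset.sum_congr rfl fun s _ => ?_
  rw [map_smul, Pi.smul_apply, e3, add_comm]
  rfl

/-- The elements of the dual basis of the chosen basis of `E`. -/
def dualBasisVec (i : Fin (Module.finrank ℝ E)) : E →L[ℝ] ℝ :=
  LinearMap.toContinuousLinearMap ((Module.finBasis ℝ E).coord i)

/-- The value at `y` of the exterior derivative of a field of forms on the model space. -/
def extDerivAt (w : E → AltForms E) (y : E) : AltForms E := extDerivModel w y

/-- The Fréchet derivative is `∑ᵢ eⁱ ⊗ ∂ᵢw`, and `d` is its alternatization, which is linear. -/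
theorem extDerivAt_eq_sum (w : E → AltForms E) (y : E) :
    extDerivAt w y =
      ∑ i, extMul (dualBasisVec i) (formDeriv w y (Module.finBasis ℝ E i)) := by
  funext k
  rw [Finset.sum_apply]
  cases k with
  | zero =>
    simp only [extMul_zero_apply, Finset.sum_const_zero]
    rfl
  | succ k =>
    have h : fderiv ℝ (fun z => w z k) y = ∑ i, (dualBasisVec i).smulRight
        (fderiv ℝ (fun z => w z k) y (Module.finBasis ℝ E i)) := by
      refine ContinuousLinearMap.ext fun u => ?_
      conv_lhs => rw [← (Module.finBasis ℝ E).sum_repr u, map_sum]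
      rw [sum_apply]
      simp only [map_smul]
      rfl
    change ContinuousAlternatingMap.alternatizeUncurryFin (fderiv ℝ (fun z => w z k) y) = _
    rw [h, ← ContinuousAlternatingMap.alternatizeUncurryFinCLM_apply, map_sum]
    rfl

/-- The Lie derivative along a field of multivectors of degree `a` on the model space. -/
def lieModel (a : ℕ) (P : E → ExteriorAlgebra ℝ E) (w : E → AltForms E) (y : E) : AltForms E :=
  extDerivAt (fun z => contractMultivector E (P z) (w z)) y -
    (-1 : ℝ) ^ a • contractMultivector E (P y) (extDerivAt w y)

/-- The sign `(-1)^a` from commuting `eⁱ ∧ -` with `ι_P` is the one in the graded commutator, so the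
terms `ι_P (eⁱ ∧ ∂ᵢw)` cancel. -/
theorem lieModel_eq_sum (a : ℕ) (P : E → ExteriorAlgebra ℝ E) (w : E → AltForms E) (y : E)
    (hPa : P y ∈ ⋀[ℝ]^a E)
    (hP : ∀ φ : Module.Dual ℝ (ExteriorAlgebra ℝ E), DifferentiableAt ℝ (fun z => φ (P z)) y)
    (hw : ∀ k, DifferentiableAt ℝ (fun z => w z k) y) :
    lieModel a P w y = ∑ i, (extMul (dualBasisVec i)
        (contractMultivector E (dirDeriv P y (Module.finBasis ℝ E i)) (w y)) +
      contractMultivector E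
        (CliffordAlgebra.contractLeft ((Module.finBasis ℝ E).coord i) (P y))
        (formDeriv w y (Module.finBasis ℝ E i))) := by
  rw [lieModel, extDerivAt_eq_sum, extDerivAt_eq_sum, map_sum, Finset.smul_sum,
    ← Finset.sum_sub_distrib]
  refine Finset.sum_congr rfl fun i _ => ?_
  rw [formDeriv_contractMultivector P w y _ hP hw, map_add,
    extMul_contractMultivector_of_mem _ a _ hPa, ← add_assoc, add_sub_cancel_right]
  rfl

theorem sign_flip {V : Type*} [AddCommGroup V] [Module ℝ V] {n : ℕ} {u v : V}
    (h : u = (-1 : ℝ) ^ n • v) : v = (-1 : ℝ) ^ n • u := by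
  rw [h, smul_smul, ← pow_add, Even.neg_one_pow ⟨n, rfl⟩, one_smul]

/-- The bracket `nu(P, Q)` is of degree `a + b - 1`, so it commutes accordingly. -/
theorem nuModel_mul_comm {a b c : ℕ} {P Q : E → ExteriorAlgebra ℝ E} {y : E}
    {R : ExteriorAlgebra ℝ E} (hP : ∀ z, P z ∈ ⋀[ℝ]^a E) (hQ : ∀ z, Q z ∈ ⋀[ℝ]^b E)
    (hR : R ∈ ⋀[ℝ]^c E) :
    R * nuModel P Q y = (-1 : ℝ) ^ ((a + b + 1) * c) • (nuModel P Q y * R) := by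
  -- Each summand of the bracket is a product of a derivative and a contracted factor, and `R` moves
  -- past them one at a time. As before, `a + b + 1` stands for `a + b - 1`.
  have key : ∀ {X Y : ExteriorAlgebra ℝ E} {m n : ℕ}, R * X = (-1 : ℝ) ^ m • (X * R) →
      R * Y = (-1 : ℝ) ^ n • (Y * R) → R * (X * Y) = (-1 : ℝ) ^ (m + n) • (X * Y * R) := by
    intro X Y m n hX hY
    rw [← mul_assoc, hX, smul_mul_assoc, mul_assoc X, hY, mul_smul_comm, smul_smul, pow_add,
      mul_assoc]
  unfold nuModel
  rw [Finset.mul_sum, Finset.sum_mul, Finset.smul_sum]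
  refine Finset.sum_congr rfl fun i _ => ?_
  set δ := (Module.finBasis ℝ E).coord i
  set v := Module.finBasis ℝ E i
  have hdP := dirDeriv_mem a P y v hP
  have hdQ := dirDeriv_mem b Q y v hQ
  have h1 := sign_flip (contractLeft_mul_comm δ (hP y) hR)
  have h2 := sign_flip (contractLeft_mul_comm δ (hQ y) hR)
  have h3 := sign_flip (mul_comm_of_mem _ _ _ _ hdP hR)
  have h4 := sign_flip (mul_comm_of_mem _ _ _ _ hdQ hR)
  rw [involute_of_mem a _ hdP, smul_mul_assoc, mul_add,
    add_mul (_ * _) (_ • _) R, mul_smul_comm, key h1 h4, key h3 h2, smul_add, smul_mul_assoc,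
    smul_comm ((-1 : ℝ) ^ a)]
  congr 3 <;> ring

/-- The Lie derivative along a product. -/
theorem lieModel_mul (a b : ℕ) (P Q : E → ExteriorAlgebra ℝ E) (w : E → AltForms E) (y : E)
    (hPa : ∀ z, P z ∈ ⋀[ℝ]^a E) (hQb : ∀ z, Q z ∈ ⋀[ℝ]^b E)
    (hP : ∀ φ : Module.Dual ℝ (ExteriorAlgebra ℝ E), DifferentiableAt ℝ (fun z => φ (P z)) y)
    (hQ : ∀ φ : Module.Dual ℝ (ExteriorAlgebra ℝ E), DifferentiableAt ℝ (fun z => φ (Q z)) y)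
    (hPQ : ∀ φ : Module.Dual ℝ (ExteriorAlgebra ℝ E),
      DifferentiableAt ℝ (fun z => φ (P z * Q z)) y)
    (hw : ∀ k, DifferentiableAt ℝ (fun z => w z k) y) :
    lieModel (a + b) (fun z => P z * Q z) w y =
      contractMultivector E (nuModel P Q y) (w y) +
        (-1 : ℝ) ^ ((a + 1) * b) • contractMultivector E (Q y) (lieModel a P w y) +
        (-1 : ℝ) ^ a • contractMultivector E (P y) (lieModel b Q w y) := by
  have hab : P y * Q y ∈ ⋀[ℝ]^(a + b) E := by
    rw [ExteriorAlgebra.exteriorPower, pow_add]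
    exact Submodule.mul_mem_mul (hPa y) (hQb y)
  rw [lieModel_eq_sum (a + b) _ w y hab hPQ hw, lieModel_eq_sum a P w y (hPa y) hP hw,
    lieModel_eq_sum b Q w y (hQb y) hQ hw, nuModel]
  simp only [map_sum, LinearMap.sum_apply, Finset.smul_sum]
  rw [← Finset.sum_add_distrib, ← Finset.sum_add_distrib]
  refine Finset.sum_congr rfl fun i _ => ?_
  set δ := (Module.finBasis ℝ E).coord i with hδ
  set v := Module.finBasis ℝ E i
  set c := CliffordAlgebra.contractLeft δ with hc
  have hcδ : ∀ a (P : ExteriorAlgebra ℝ E), P ∈ ⋀[ℝ]^a E → ∀ α, extMul (dualBasisVec i)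
      (contractMultivector E P α) = contractMultivector E (c P) α +
        (-1 : ℝ) ^ a • contractMultivector E P (extMul (dualBasisVec i) α) := fun a P hP α =>
    extMul_contractMultivector_of_mem (dualBasisVec i) a P hP α
  have hdP := dirDeriv_mem a P y v hPa
  have hdQ := dirDeriv_mem b Q y v hQb
  have hs : ∀ n : ℕ, (-1 : ℝ) ^ n * (-1) ^ n = 1 := fun n => by rw [← mul_pow]; simp
  -- Products with a differentiated or contracted `P` are reordered to put the `Q` factor outermost,
  -- as in `ι_Q L_P`.
  have h1 : dirDeriv P y v * Q y = (-1 : ℝ) ^ (a * b) • (Q y * dirDeriv P y v) :=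
    mul_comm_of_mem _ _ _ _ hdP (hQb y)
  have h2 : c (P y) * Q y = (-1 : ℝ) ^ ((a + 1) * b) • (Q y * c (P y)) :=
    contractLeft_mul_comm δ (hPa y) (hQb y)
  have h3 : dirDeriv P y v * c (Q y) =
      ((-1 : ℝ) ^ a * (-1 : ℝ) ^ (a * b)) • (c (Q y) * dirDeriv P y v) := by
    rw [hc, contractLeft_mul_comm δ (hQb y) hdP, smul_smul]
    have e : (-1 : ℝ) ^ a * (-1) ^ (a * b) * (-1) ^ ((b + 1) * a) = 1 := by
      rw [← pow_add, ← pow_add]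
      exact Even.neg_one_pow ⟨a + a * b, by ring⟩
    rw [e, one_smul]
  rw [dirDeriv_mul P Q y v hP hQ, involute_of_mem a _ hdP, hc, contractLeft_mul_of_mem δ a _ _ (hPa y),
    ← hc, h1, h2, smul_mul_assoc, h3]
  simp only [map_add, map_smul, map_mul, LinearMap.add_apply, LinearMap.smul_apply,
    Module.End.mul_apply, smul_add, smul_smul]
  -- Commuting `eⁱ ∧ -` past the outer `ι_Q` and `ι_P` creates `ι_{eⁱ⌟Q} ι_{∂ᵢP}` and `ι_{eⁱ⌟P}
  -- ι_{∂ᵢQ}`, the two halves of the bracket. The rest is `ι_Q L_P` and `ι_P L_Q`.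
  rw [hcδ b _ (hQb y), hcδ a _ (hPa y)]
  rw [show (-1 : ℝ) ^ a * ((-1 : ℝ) ^ a * (-1 : ℝ) ^ (a * b)) = (-1 : ℝ) ^ (a * b) by
    rw [← mul_assoc, hs, one_mul]]
  rw [show (-1 : ℝ) ^ ((a + 1) * b) = (-1 : ℝ) ^ (a * b) * (-1 : ℝ) ^ b by ring]
  simp only [smul_add, smul_smul]
  abel

end Model

/-! ### Lie derivatives and brackets of products of several factors -/

section Degrees

/-- The sum of the degrees of the elements in front of the `p`-th one. -/
def precDeg {n : ℕ} (a : Fin (n + 1) → ℕ) (p : Fin (n + 1)) : ℕ :=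
  ∑ l : Fin n, if p.succAbove l < p then a (p.succAbove l) else 0

/-- The sum of the degrees of the elements behind the `p`-th one. -/
def succDeg {n : ℕ} (a : Fin (n + 1) → ℕ) (p : Fin (n + 1)) : ℕ :=
  ∑ l : Fin n, if p < p.succAbove l then a (p.succAbove l) else 0

theorem precDeg_zero {n : ℕ} (a : Fin (n + 1) → ℕ) : precDeg a 0 = 0 := by
  simp [precDeg]

theorem precDeg_succ {n : ℕ} (a : Fin (n + 2) → ℕ) (p : Fin (n + 1)) :
    precDeg a p.succ = a 0 + precDeg (fun i => a i.succ) p := by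
  simp [precDeg, Fin.sum_univ_succ (n := n)]

theorem succDeg_zero {n : ℕ} (a : Fin (n + 1) → ℕ) : succDeg a 0 = ∑ i : Fin n, a i.succ := by
  simp [succDeg]

theorem neg_one_pow_eq_of_eq_add {m n : ℕ} (k : ℕ) (h : m = n + 2 * k) :
    (-1 : ℝ) ^ m = (-1 : ℝ) ^ n := by
  rw [h, pow_add, pow_mul]
  simp

theorem succDeg_succ {n : ℕ} (a : Fin (n + 2) → ℕ) (p : Fin (n + 1)) :
    succDeg a p.succ = succDeg (fun i => a i.succ) p := by
  simp [succDeg, Fin.sum_univ_succ (n := n)]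

end Degrees

section Products

variable {E : Type*} [NormedAddCommGroup E] [NormedSpace ℝ E]

theorem list_prod_mem_exteriorPower {n : ℕ} {a : Fin n → ℕ} {P : Fin n → ExteriorAlgebra ℝ E}
    (hP : ∀ i, P i ∈ ⋀[ℝ]^(a i) E) : (List.ofFn P).prod ∈ ⋀[ℝ]^(∑ i, a i) E := by
  induction n with
  | zero => simp [ExteriorAlgebra.exteriorPower, Submodule.mem_one]
  | succ n ih =>
    rw [List.ofFn_succ, List.prod_cons, Fin.sum_univ_succ, ExteriorAlgebra.exteriorPower, pow_add]
    exact Submodule.mul_mem_mul (hP 0) (ih fun i => hP i.succ)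

/-- Differentiability at a point of a function with values in the exterior algebra. -/
def MvDifferentiableAt (P : E → ExteriorAlgebra ℝ E) (y : E) : Prop :=
  ∀ φ : Module.Dual ℝ (ExteriorAlgebra ℝ E), DifferentiableAt ℝ (fun z => φ (P z)) y

theorem mvDifferentiableAt_const (c : ExteriorAlgebra ℝ E) (y : E) :
    MvDifferentiableAt (fun _ => c) y :=
  fun _ => differentiableAt_const _

variable [FiniteDimensional ℝ E]

theorem MvDifferentiableAt.mul {P Q : E → ExteriorAlgebra ℝ E} {y : E}
    (hP : MvDifferentiableAt P y) (hQ : MvDifferentiableAt Q y) :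
    MvDifferentiableAt (fun z => P z * Q z) y := by
  intro φ
  set B := (Module.finBasis ℝ E).ExteriorAlgebra
  have e : (fun z => φ (P z * Q z)) = fun z => ∑ t, ∑ u,
      (B.repr (P z) t * B.repr (Q z) u) * φ (B t * B u) := by
    funext z
    conv_lhs => rw [← B.sum_repr (P z), ← B.sum_repr (Q z), Finset.sum_mul_sum]
    simp only [smul_mul_smul_comm, map_sum, map_smul, smul_eq_mul]
  rw [e]
  exact DifferentiableAt.fun_sum fun t _ => DifferentiableAt.fun_sum fun u _ =>
    ((hP (B.coord t)).mul (hQ (B.coord u))).mul_const _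

theorem MvDifferentiableAt.list_prod {n : ℕ} {P : Fin n → E → ExteriorAlgebra ℝ E} {y : E}
    (hP : ∀ i, MvDifferentiableAt (P i) y) :
    MvDifferentiableAt (fun z => (List.ofFn fun i => P i z).prod) y := by
  induction n with
  | zero => simpa using mvDifferentiableAt_const 1 y
  | succ n ih =>
    simp only [List.ofFn_succ, List.prod_cons]
    exact (hP 0).mul (ih fun i => hP i.succ)

/-- The Leibniz rule for the bracket with a product of several factors. -/
theorem nuModel_list_prod {n c : ℕ} {a : Fin (n + 1) → ℕ} {P : Fin (n + 1) → E → ExteriorAlgebra ℝ E}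
    {R : E → ExteriorAlgebra ℝ E} {y : E} (hR : ∀ z, R z ∈ ⋀[ℝ]^c E)
    (hPa : ∀ i z, P i z ∈ ⋀[ℝ]^(a i) E) (hP : ∀ i, MvDifferentiableAt (P i) y) :
    nuModel R (fun z => (List.ofFn fun i => P i z).prod) y =
      ∑ q, (-1 : ℝ) ^ (a q * precDeg a q) •
        (nuModel R (P q) y * (List.ofFn fun k => P (q.succAbove k) y).prod) := by
  induction n with
  | zero => simp [precDeg]
  | succ n ih =>
    simp only [List.ofFn_succ (n := n + 1), List.prod_cons]
    rw [nuModel_mul c (a 0) R (P 0) _ y hR (hPa 0) (hP 0)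
      (MvDifferentiableAt.list_prod fun i => hP i.succ),
      ih (fun i => hPa i.succ) (fun i => hP i.succ), Fin.sum_univ_succ (n := n + 1), precDeg_zero]
    simp only [mul_zero, pow_zero, one_smul, Fin.succAbove_zero]
    congr 1
    rw [Finset.mul_sum, Finset.smul_sum]
    refine Finset.sum_congr rfl fun q _ => ?_
    simp only [List.ofFn_succ, List.prod_cons, Fin.succ_succAbove_zero, Fin.succ_succAbove_succ]
    -- `P 0` moves past the bracket to rejoin the remaining factors. The sign of this move and the
    -- Leibniz sign combine to `(-1)^(a q · a 0)`, the extra term in `precDeg`.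
    rw [mul_smul_comm, ← mul_assoc (P 0 y), nuModel_mul_comm hR (hPa q.succ) (hPa 0 y),
      smul_mul_assoc, smul_smul, smul_smul, mul_assoc (nuModel _ _ _), precDeg_succ, ← pow_add, ← pow_add]
    congr 1
    exact neg_one_pow_eq_of_eq_add (c * a 0 + a 0) (by ring)

/-- The higher brackets at a point of the model space, by recursion on the number of arguments. -/
def nuRec : (n : ℕ) → (Fin n → ℕ) → (Fin n → E → ExteriorAlgebra ℝ E) → E → ExteriorAlgebra ℝ E
  | 0, _, _, _ => 0
  | 1, _, _, _ => 0
  | n + 2, a, P, y => nuModel (P 0) (fun z => (List.ofFn fun i : Fin (n + 1) => P i.succ z).prod) y +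
      (-1 : ℝ) ^ a 0 • (P 0 y * nuRec (n + 1) (fun i => a i.succ) (fun i => P i.succ) y)

/-- The row `p = 0` is the Leibniz expansion of the first term of the recursion; the other rows come
from the bracket of the tail. The index `q` is a position after deletion of `p`, and `p ≤
q.castSucc` says that the second element lies behind the first. -/
theorem nuRec_eq_sum {n : ℕ} {a : Fin (n + 2) → ℕ} {P : Fin (n + 2) → E → ExteriorAlgebra ℝ E}
    {y : E} (hPa : ∀ i z, P i z ∈ ⋀[ℝ]^(a i) E) (hP : ∀ i, MvDifferentiableAt (P i) y) :
    nuRec (n + 2) a P y = ∑ p, ∑ q : Fin (n + 1), if p ≤ q.castSucc then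
      (-1 : ℝ) ^ (a p * precDeg a p + a (p.succAbove q) *
        precDeg (fun i => a (p.succAbove i)) q) •
        (nuModel (P p) (P (p.succAbove q)) y *
          (List.ofFn fun k => P (p.succAbove (q.succAbove k)) y).prod) else 0 := by
  induction n with
  | zero =>
    rw [Fin.sum_univ_succ, nuRec, nuModel_list_prod (hPa 0) (fun i => hPa i.succ)
      fun i => hP i.succ]
    simp [nuRec, precDeg_zero]
  | succ n ih =>
    rw [Fin.sum_univ_succ, nuRec, nuModel_list_prod (hPa 0) (fun i => hPa i.succ)
      fun i => hP i.succ, ih (fun i => hPa i.succ) fun i => hP i.succ]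
    simp only [Fin.zero_le, if_true, precDeg_zero, mul_zero, zero_add, Fin.succAbove_zero]
    congr 1
    rw [Finset.mul_sum, Finset.smul_sum]
    refine Finset.sum_congr rfl fun p _ => ?_
    -- In the row `p.succ`, `q = 0` would pair with the element at position `0`, which lies in
    -- front, so it does not contribute.
    rw [Fin.sum_univ_succ (n := n + 1), if_neg (by simp), zero_add,
      Finset.mul_sum, Finset.smul_sum]
    refine Finset.sum_congr rfl fun q _ => ?_
    simp only [← Fin.succ_castSucc, Fin.succ_le_succ_iff, mul_ite, smul_ite, mul_zero, smul_zero]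
    split_ifs with h
    · simp only [List.ofFn_succ, List.prod_cons, Fin.succ_succAbove_zero, Fin.succ_succAbove_succ,
        precDeg_succ]
      rw [mul_smul_comm, ← mul_assoc (P 0 y),
        nuModel_mul_comm (hPa p.succ) (hPa (p.succAbove q).succ) (hPa 0 y),
        smul_mul_assoc, smul_smul, smul_smul, mul_assoc (nuModel _ _ _), ← pow_add, ← pow_add]
      congr 1
      exact neg_one_pow_eq_of_eq_add (a 0) (by ring)
    · rfl

/-- The Lie derivative along a product of several factors. -/
theorem lieModel_list_prod {n : ℕ} {a : Fin (n + 1) → ℕ}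
    {P : Fin (n + 1) → E → ExteriorAlgebra ℝ E} {w : E → AltForms E} {y : E}
    (hPa : ∀ i z, P i z ∈ ⋀[ℝ]^(a i) E) (hP : ∀ i, MvDifferentiableAt (P i) y)
    (hw : ∀ k, DifferentiableAt ℝ (fun z => w z k) y) :
    lieModel (∑ i, a i) (fun z => (List.ofFn fun i => P i z).prod) w y =
      contractMultivector E (nuRec (n + 1) a P y) (w y) +
        ∑ p, (-1 : ℝ) ^ (∑ i, a i + a p * succDeg a p + a p) •
          contractMultivector E (List.ofFn fun i => P (p.succAbove i) y).prod
            (lieModel (a p) (P p) w y) := by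
  induction n with
  | zero => simp [nuRec, succDeg, ← two_mul]
  | succ n ih =>
    have hprod := fun z => list_prod_mem_exteriorPower fun i : Fin (n + 1) => hPa i.succ z
    have hd := MvDifferentiableAt.list_prod fun i : Fin (n + 1) => hP i.succ
    simp only [List.ofFn_succ (n := n + 1), List.prod_cons]
    rw [Fin.sum_univ_succ (fun i => a i), lieModel_mul (a 0) _ (P 0) _ w y (hPa 0) hprod (hP 0) hd
      ((hP 0).mul hd) hw, ih (fun i => hPa i.succ) fun i => hP i.succ, nuRec,
      Fin.sum_univ_succ (n := n + 1)]
    simp only [map_add, map_smul, map_mul, map_sum, LinearMap.add_apply, LinearMap.smul_apply,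
      Module.End.mul_apply, smul_add, Finset.smul_sum]
    -- The unshuffle sign for `p = 0` agrees with the sign of `ι_Q L_P` in the two-factor formula.
    -- In `e2`, the signs for the other `p` gain `(-1)^(a 0)`, that of `ι_P L_Q`.
    have e1 : (-1 : ℝ) ^ (a 0 + ∑ i : Fin (n + 1), a i.succ + a 0 * succDeg a 0 + a 0) =
        (-1 : ℝ) ^ ((a 0 + 1) * ∑ i : Fin (n + 1), a i.succ) := by
      rw [succDeg_zero]
      exact neg_one_pow_eq_of_eq_add (a 0) (by ring)
    have e2 : ∀ p : Fin (n + 1),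
        (-1 : ℝ) ^ (a 0 + ∑ i : Fin (n + 1), a i.succ + a p.succ * succDeg a p.succ + a p.succ) •
          contractMultivector E (List.ofFn fun i => P (p.succ.succAbove i) y).prod
            (lieModel (a p.succ) (P p.succ) w y) =
        (-1 : ℝ) ^ a 0 • (-1 : ℝ) ^ (∑ i : Fin (n + 1), a i.succ +
          a p.succ * succDeg (fun i => a i.succ) p + a p.succ) •
            contractMultivector E (P 0 y)
              (contractMultivector E (List.ofFn fun i => P (p.succAbove i).succ y).prod
                (lieModel (a p.succ) (P p.succ) w y)) := by
      intro p
      simp only [List.ofFn_succ, List.prod_cons, Fin.succ_succAbove_zero, Fin.succ_succAbove_succ,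
        succDeg_succ, map_mul, Module.End.mul_apply]
      rw [smul_smul, ← pow_add]
      congr 2
      ring
    simp only [e1, e2, Fin.succAbove_zero]
    abel

end Products

/-! ### Sums over unshuffles -/

section Unshuffles

/-- The Koszul sign of a permutation, by removing the element in the first position. -/
theorem koszulSign_of_succ {n : ℕ} (a : Fin (n + 1) → ℕ) (σ : Equiv.Perm (Fin (n + 1)))
    (τ : Equiv.Perm (Fin n)) (h : ∀ i, σ i.succ = (σ 0).succAbove (τ i)) :
    koszulSign a σ = (-1 : ℝ) ^ (a (σ 0) * precDeg a (σ 0)) *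
      koszulSign (fun i => a ((σ 0).succAbove i)) τ := by
  unfold koszulSign precDeg
  rw [Finset.prod_filter, Finset.prod_filter, Fintype.prod_prod_type, Fintype.prod_prod_type,
    Fin.prod_univ_succ]
  congr 1
  · rw [Fin.prod_univ_succ, ← Equiv.sum_comp τ, Finset.mul_sum, ← Finset.prod_pow_eq_pow_sum]
    simp only [lt_self_iff_false, false_and, if_false, one_mul, h]
    refine Finset.prod_congr rfl fun i _ => ?_
    by_cases hi : (σ 0).succAbove (τ i) < σ 0 <;> simp [hi]
  · refine Finset.prod_congr rfl fun i _ => ?_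
    rw [Fin.prod_univ_succ]
    simp [h, (Fin.strictMono_succAbove _).lt_iff_lt]

/-- The Koszul sign of a permutation, by removing the element in the last position. -/
theorem koszulSign_of_castSucc {n : ℕ} (a : Fin (n + 1) → ℕ) (σ : Equiv.Perm (Fin (n + 1)))
    (τ : Equiv.Perm (Fin n)) (h : ∀ i, σ i.castSucc = (σ (Fin.last n)).succAbove (τ i)) :
    koszulSign a σ = (-1 : ℝ) ^ (a (σ (Fin.last n)) * succDeg a (σ (Fin.last n))) *
      koszulSign (fun i => a ((σ (Fin.last n)).succAbove i)) τ := by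
  unfold koszulSign succDeg
  rw [Finset.prod_filter, Finset.prod_filter, Fintype.prod_prod_type, Fintype.prod_prod_type,
    Fin.prod_univ_castSucc]
  -- No pair has its smaller index in the last position; that block of factors is trivial.
  rw [Finset.prod_eq_one (f := fun j => if Fin.last n < j ∧ _ then _ else _)
    fun j _ => if_neg fun hj => (Fin.le_last j).not_gt hj.1, mul_one, ← Equiv.sum_comp τ, Finset.mul_sum,
    ← Finset.prod_pow_eq_pow_sum, ← Finset.prod_mul_distrib]
  refine Finset.prod_congr rfl fun i _ => ?_
  rw [Fin.prod_univ_castSucc, mul_comm]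
  congr 1
  · by_cases hi : σ (Fin.last n) < (σ (Fin.last n)).succAbove (τ i) <;>
      simp [hi, h, Fin.castSucc_lt_last, mul_comm]
  · simp [h, (Fin.strictMono_succAbove _).lt_iff_lt]

theorem koszulSign_one {n : ℕ} (a : Fin n → ℕ) : koszulSign a 1 = 1 :=
  Finset.prod_eq_one fun q hq => by
    rw [Finset.mem_filter] at hq
    exact absurd hq.2.1 hq.2.2.not_gt

/-- The permutation with `0 ↦ p` that is `τ` on the other elements. -/
def permCons {n : ℕ} (p : Fin (n + 1)) (τ : Equiv.Perm (Fin n)) : Equiv.Perm (Fin (n + 1)) :=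
  (finSuccEquiv n).trans ((Equiv.optionCongr τ).trans (finSuccEquiv' p).symm)

/-- The permutation with `n ↦ p` that is increasing on the other elements. -/
def permLast {n : ℕ} (p : Fin (n + 1)) : Equiv.Perm (Fin (n + 1)) :=
  finSuccEquivLast.trans (finSuccEquiv' p).symm

variable {n : ℕ}

theorem permCons_zero (p : Fin (n + 1)) (τ : Equiv.Perm (Fin n)) : permCons p τ 0 = p := by
  simp [permCons]

theorem permCons_succ (p : Fin (n + 1)) (τ : Equiv.Perm (Fin n)) (i : Fin n) :
    permCons p τ i.succ = p.succAbove (τ i) := by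
  simp [permCons]

theorem permLast_last (p : Fin (n + 1)) : permLast p (Fin.last n) = p := by
  simp [permLast]

theorem permLast_castSucc (p : Fin (n + 1)) (i : Fin n) :
    permLast p i.castSucc = p.succAbove i := by
  simp [permLast]

theorem mem_unshuffles {p : ℕ} {σ : Equiv.Perm (Fin n)} :
    σ ∈ unshuffles p n ↔ ∀ i j : Fin n, i < j → (j.val < p ∨ p ≤ i.val) → σ i < σ j := by
  simp [unshuffles]

/-- An increasing function to `Fin (n + 1)` whose values are all but one is unique. -/
theorem eq_succAbove_of_strictMono {f : Fin n → Fin (n + 1)} (hf : StrictMono f) {p : Fin (n + 1)}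
    (hp : ∀ i, f i ≠ p) : f = p.succAbove := by
  refine (hf.range_inj (Fin.strictMono_succAbove p)).1 ?_
  rw [Fin.range_succAbove]
  refine Set.eq_of_subset_of_ncard_le (fun x ⟨i, hi⟩ => hi ▸ hp i) ?_
  rw [Set.ncard_compl, Set.ncard_singleton, ← Set.image_univ, Set.ncard_image_of_injective _ hf.injective]
  simp

theorem permLast_mem (p : Fin (n + 1)) : permLast p ∈ unshuffles n (n + 1) := by
  rw [mem_unshuffles]
  intro i j hij h
  cases j using Fin.lastCases with
  | last =>
    cases i using Fin.lastCases with
    | last => exact absurd hij (lt_irrefl _)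
    | cast i => simp at h; omega
  | cast j =>
    cases i using Fin.lastCases with
    | last => exact absurd hij (Fin.le_last _).not_gt
    | cast i =>
      rw [permLast_castSucc, permLast_castSucc]
      exact Fin.strictMono_succAbove p hij

/-- Monotonicity on the first `n` positions leaves only the last value free. -/
theorem eq_permLast_of_mem {σ : Equiv.Perm (Fin (n + 1))} (h : σ ∈ unshuffles n (n + 1)) :
    σ = permLast (σ (Fin.last n)) := by
  have e := eq_succAbove_of_strictMono (f := fun i => σ i.castSucc) (p := σ (Fin.last n))
    (fun i j hij => mem_unshuffles.1 h _ _ hij (Or.inl j.isLt))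
    fun i hi => (Fin.castSucc_lt_last i).ne (σ.injective hi)
  refine Equiv.ext fun i => ?_
  cases i using Fin.lastCases with
  | last => rw [permLast_last]
  | cast i => rw [permLast_castSucc, ← e]

theorem sum_unshuffles_last {V : Type*} [AddCommMonoid V] (f : Equiv.Perm (Fin (n + 1)) → V) :
    ∑ σ ∈ unshuffles n (n + 1), f σ = ∑ p, f (permLast p) := by
  refine Finset.sum_nbij' (fun σ => σ (Fin.last n)) permLast (fun _ _ => Finset.mem_univ _)
    (fun p _ => permLast_mem p) (fun σ hσ => (eq_permLast_of_mem hσ).symm)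
    (fun p _ => permLast_last p) fun σ hσ => congrArg f (eq_permLast_of_mem hσ)

theorem koszulSign_permLast (a : Fin (n + 1) → ℕ) (p : Fin (n + 1)) :
    koszulSign a (permLast p) = (-1 : ℝ) ^ (a p * succDeg a p) := by
  rw [koszulSign_of_castSucc a (permLast p) 1 fun i => by
    rw [permLast_castSucc, permLast_last, Equiv.Perm.one_apply], koszulSign_one, permLast_last,
    mul_one]

/-- The permutation `0 ↦ p`, `1 ↦ p.succAbove q` that is increasing on the other elements. -/
def permTwo (p : Fin (n + 2)) (q : Fin (n + 1)) : Equiv.Perm (Fin (n + 2)) :=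
  permCons p (permCons q 1)

theorem permTwo_zero (p : Fin (n + 2)) (q : Fin (n + 1)) : permTwo p q 0 = p :=
  permCons_zero _ _

theorem permTwo_one (p : Fin (n + 2)) (q : Fin (n + 1)) : permTwo p q 1 = p.succAbove q := by
  rw [← Fin.succ_zero_eq_one, permTwo, permCons_succ, permCons_zero]

theorem permTwo_succ_succ (p : Fin (n + 2)) (q : Fin (n + 1)) (i : Fin n) :
    permTwo p q i.succ.succ = p.succAbove (q.succAbove i) := by
  rw [permTwo, permCons_succ, permCons_succ, Equiv.Perm.one_apply]

theorem koszulSign_permTwo (a : Fin (n + 2) → ℕ) (p : Fin (n + 2)) (q : Fin (n + 1)) :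
    koszulSign a (permTwo p q) = (-1 : ℝ) ^ (a p * precDeg a p + a (p.succAbove q) *
        precDeg (fun i => a (p.succAbove i)) q) := by
  have h1 := koszulSign_of_succ a (permTwo p q) (permCons q 1) fun i => by
    rw [permTwo, permCons_succ, permCons_zero]
  have h2 := koszulSign_of_succ (fun i => a (p.succAbove i)) (permCons q 1) 1 fun i => by
    rw [permCons_succ, permCons_zero]
  rw [permTwo_zero, h2, koszulSign_one, permCons_zero, mul_one, ← pow_add] at h1
  exact h1

theorem permTwo_mem {p : Fin (n + 2)} {q : Fin (n + 1)} (h : p ≤ q.castSucc) :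
    permTwo p q ∈ unshuffles 2 (n + 2) := by
  rw [mem_unshuffles]
  intro i j hij hc
  rcases hc with hc | hc
  · have hi : i = 0 := by ext; rw [Fin.val_zero]; omega
    have hj : j = 1 := by ext; rw [Fin.val_one]; omega
    rw [hi, hj, permTwo_zero, permTwo_one]
    exact (Fin.lt_succAbove_iff_le_castSucc _ _).2 h
  · obtain ⟨i, rfl⟩ : ∃ i' : Fin n, i = i'.succ.succ :=
      ⟨⟨i - 2, by omega⟩, by apply Fin.ext; simp; omega⟩
    obtain ⟨j, rfl⟩ : ∃ j' : Fin n, j = j'.succ.succ :=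
      ⟨⟨j - 2, by omega⟩, by apply Fin.ext; simp; omega⟩
    rw [permTwo_succ_succ, permTwo_succ_succ]
    exact Fin.strictMono_succAbove _ (Fin.strictMono_succAbove _ (by simpa using hij))

/-- Deleting the value `σ 0` turns the other values into a map `ρ`, whose tail is increasing and
omits only `ρ 0`. The first two values thus determine `σ`. -/
theorem exists_permTwo_of_mem {σ : Equiv.Perm (Fin (n + 2))} (h : σ ∈ unshuffles 2 (n + 2)) :
    ∃ p q, p ≤ q.castSucc ∧ permTwo p q = σ := by
  rw [mem_unshuffles] at h
  have hne : ∀ i : Fin (n + 1), σ i.succ ≠ σ 0 := fun i hi => Fin.succ_ne_zero i (σ.injective hi)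
  choose ρ hρ using fun i => Fin.exists_succAbove_eq (hne i)
  have h01 : σ 0 < σ 1 := h 0 1 (by simp) (Or.inl (by simp))
  have e := eq_succAbove_of_strictMono (f := fun i : Fin n => ρ i.succ) (p := ρ 0)
    (fun i j hij => by
      rw [← (Fin.strictMono_succAbove (σ 0)).lt_iff_lt, hρ, hρ]
      exact h _ _ (by simpa using hij) (Or.inr (by simp)))
    (fun i hi => by
      have := congrArg (σ 0).succAbove hi
      rw [hρ, hρ] at this
      exact Fin.succ_ne_zero i (Fin.succ_injective _ (σ.injective this)))
  refine ⟨σ 0, ρ 0, ?_, Equiv.ext fun i => ?_⟩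
  · rw [← Fin.succ_zero_eq_one, ← hρ 0, Fin.lt_succAbove_iff_le_castSucc] at h01
    exact h01
  · cases i using Fin.cases with
    | zero => exact permTwo_zero _ _
    | succ i =>
      cases i using Fin.cases with
      | zero => rw [Fin.succ_zero_eq_one, permTwo_one, hρ, Fin.succ_zero_eq_one]
      | succ i => rw [permTwo_succ_succ, ← e, hρ]

/-- This brings `higherNu` to the shape of the double sum in `nuRec_eq_sum`. -/
theorem sum_unshuffles_two {V : Type*} [AddCommMonoid V] (f : Equiv.Perm (Fin (n + 2)) → V) :
    ∑ σ ∈ unshuffles 2 (n + 2), f σ =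
      ∑ p, ∑ q : Fin (n + 1), if p ≤ q.castSucc then f (permTwo p q) else 0 := by
  rw [← Fintype.sum_prod_type' (f := fun p q => if p ≤ q.castSucc then f (permTwo p q) else 0),
    ← Finset.sum_filter]
  symm
  refine Finset.sum_nbij (fun x : Fin (n + 2) × Fin (n + 1) => permTwo x.1 x.2)
    (fun x hx => permTwo_mem (Finset.mem_filter.1 hx).2) ?_ ?_ fun _ _ => rfl
  · rintro ⟨p, q⟩ _ ⟨p', q'⟩ _ hx
    have h0 : p = p' := by simpa only [permTwo_zero] using Equiv.congr_fun hx 0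
    subst h0
    have h1 := Equiv.congr_fun hx 1
    simp only [permTwo_one, Fin.succAbove_right_inj] at h1
    rw [h1]
  · intro σ hσ
    obtain ⟨p, q, hpq, e⟩ := exists_permTwo_of_mem hσ
    exact ⟨(p, q), by simpa using hpq, e⟩

end Unshuffles

/-! ### Transfer to the preferred chart at a point -/

section Chart

open Filter Topology

variable {E : Type*} [NormedAddCommGroup E] [NormedSpace ℝ E]
  {M : Type*} [TopologicalSpace M] [ChartedSpace E M]

/-- The value of a field of multivectors at a point, as a multivector on the model space. -/
def mvAt (P : MvField E M) (p : M) : ExteriorAlgebra ℝ E := P p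

/-- The value of a field of forms at a point, as a family of forms on the model space. -/
def formAt (w : FormField E M) (p : M) : AltForms E := w p

theorem formAt_contract (P : MvField E M) (w : FormField E M) (p : M) :
    formAt (contract P w) p = contractMultivector E (mvAt P p) (formAt w p) := rfl

/-- A field of multivectors in the preferred chart at `p`. -/
def chartMv (p : M) (P : MvField E M) : E → ExteriorAlgebra ℝ E :=
  MvField.pullback (extChartAt 𝓘(ℝ, E) p).symm P

/-- A field of forms in the preferred chart at `p`. -/
def chartForm (p : M) (w : FormField E M) : E → AltForms E :=
  FormField.pullback (extChartAt 𝓘(ℝ, E) p).symm w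

/-- The derivative at `p` of the preferred chart at `p`, as an endomorphism of the model space. -/
def chartDerivAt (p : M) : E →L[ℝ] E :=
  mfderiv 𝓘(ℝ, E) 𝓘(ℝ, E) (extChartAt 𝓘(ℝ, E) p) p

/-- The derivative of the inverse of the preferred chart at `p`, as an endomorphism of the model
space. -/
def chartDeriv (p : M) (z : E) : E →L[ℝ] E :=
  mfderiv 𝓘(ℝ, E) 𝓘(ℝ, E) (extChartAt 𝓘(ℝ, E) p).symm z

theorem chartMv_apply (p : M) (P : MvField E M) (z : E) :
    chartMv p P z = ExteriorAlgebra.map ((chartDeriv p z).inverse : E →ₗ[ℝ] E)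
      (mvAt P ((extChartAt 𝓘(ℝ, E) p).symm z)) := rfl

theorem chartForm_apply (p : M) (w : FormField E M) (z : E) :
    chartForm p w z = AltForms.comp (chartDeriv p z)
      (formAt w ((extChartAt 𝓘(ℝ, E) p).symm z)) := rfl

theorem map_mem_exteriorPower {V W : Type*} [AddCommGroup V] [Module ℝ V] [AddCommGroup W]
    [Module ℝ W] (f : V →ₗ[ℝ] W) {a : ℕ} {P : ExteriorAlgebra ℝ V} (hP : P ∈ ⋀[ℝ]^a V) :
    ExteriorAlgebra.map f P ∈ ⋀[ℝ]^a W := by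
  have h := Submodule.mem_map_of_mem (f := (ExteriorAlgebra.map f).toLinearMap) hP
  rw [ExteriorAlgebra.exteriorPower, Submodule.map_pow] at h
  refine (pow_le_pow_left' (?_ : _ ≤ LinearMap.range (ExteriorAlgebra.ι ℝ)) a : _ ≤ _) h
  rintro _ ⟨_, ⟨v, rfl⟩, rfl⟩
  exact ⟨f v, (ExteriorAlgebra.map_apply_ι f v).symm⟩

theorem chartMv_mem {a : ℕ} {P : MvField E M}
    (hP : ∀ p, P p ∈ ⋀[ℝ]^a (TangentSpace 𝓘(ℝ, E) p)) (p : M) (z : E) :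
    chartMv p P z ∈ ⋀[ℝ]^a E := by
  rw [chartMv_apply]
  exact map_mem_exteriorPower _ (hP ((extChartAt 𝓘(ℝ, E) p).symm z))

theorem chartMv_list_prod {n : ℕ} (p : M) (P : Fin n → MvField E M) (z : E) :
    chartMv p (List.ofFn P).prod z = (List.ofFn fun i => chartMv p (P i) z).prod := by
  have h : ∀ l : List (MvField E M),
      chartMv p l.prod z = (l.map fun Q => chartMv p Q z).prod := by
    intro l
    induction l with
    | nil => exact map_one (ExteriorAlgebra.map ((chartDeriv p z).inverse : E →ₗ[ℝ] E))
    | cons Q l ih =>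
      rw [List.prod_cons, List.map_cons, List.prod_cons, ← ih]
      exact map_mul (ExteriorAlgebra.map ((chartDeriv p z).inverse : E →ₗ[ℝ] E)) _ _
  rw [h, List.map_ofFn]
  rfl

theorem extDerivAt_congr {w w' : E → AltForms E} {y : E} (h : w =ᶠ[𝓝 y] w') :
    extDerivAt w y = extDerivAt w' y := by
  funext k
  cases k with
  | zero => rfl
  | succ k =>
    have e : (fun z => w z k) =ᶠ[𝓝 y] fun z => w' z k := h.mono fun z hz => congrFun hz k
    exact congrArg ContinuousAlternatingMap.alternatizeUncurryFin e.fderiv_eq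

theorem chartMv_differentiableAt {P : MvField E M} (hP : P.IsSmooth) (p : M) :
    MvDifferentiableAt (chartMv p P) (extChartAt 𝓘(ℝ, E) p p) := fun φ =>
  ((hP p φ).contDiffAt (extChartAt_target_mem_nhds (I := 𝓘(ℝ, E)) p)).differentiableAt (by simp)

theorem chartForm_differentiableAt {w : FormField E M} (hw : w.IsSmooth) (p : M) (k : ℕ) :
    DifferentiableAt ℝ (fun z => chartForm p w z k) (extChartAt 𝓘(ℝ, E) p p) :=
  ((hw p k).contDiffAt (extChartAt_target_mem_nhds (I := 𝓘(ℝ, E)) p)).differentiableAt (by simp)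

theorem mvAt_pullback (p : M) (P : E → ExteriorAlgebra ℝ E) :
    mvAt (MvField.pullback (extChartAt 𝓘(ℝ, E) p) (P : MvField E E)) p =
      ExteriorAlgebra.map ((chartDerivAt (E := E) p).inverse : E →ₗ[ℝ] E)
        (P (extChartAt 𝓘(ℝ, E) p p)) := rfl

theorem contract_zero (P : MvField E M) : contract P 0 = 0 := by
  funext p
  exact map_zero (contractMultivector E (mvAt P p))

theorem lieDerivative_of_closed (a : ℕ) (P : MvField E M) {w : FormField E M} (hw : d w = 0) :
    lieDerivative a P w = d (contract P w) := by
  rw [lieDerivative, hw, contract_zero, smul_zero, sub_zero]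

variable [IsManifold 𝓘(ℝ, E) ∞ M]

/-- The tangent space at `p` is identified with `E` through the preferred chart at `p`, so in that
chart pullbacks do not change values at `p`. -/
theorem chartDeriv_self (p : M) :
    chartDeriv p (extChartAt 𝓘(ℝ, E) p p) = ContinuousLinearMap.id ℝ E := by
  have : IsManifold 𝓘(ℝ, E) 1 M := IsManifold.of_le (n := ∞) (by norm_num)
  have h := mfderivWithin_range_extChartAt_symm (I := 𝓘(ℝ, E)) (x := p)
  rw [modelWithCornersSelf_coe, Set.range_id, mfderivWithin_univ] at h
  exact h

theorem chartDeriv_isInvertible (p : M) {z : E} (hz : z ∈ (extChartAt 𝓘(ℝ, E) p).target) :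
    (chartDeriv p z).IsInvertible := by
  have : IsManifold 𝓘(ℝ, E) 1 M := IsManifold.of_le (n := ∞) (by norm_num)
  have h := isInvertible_mfderivWithin_extChartAt_symm (I := 𝓘(ℝ, E)) hz
  rw [modelWithCornersSelf_coe, Set.range_id, mfderivWithin_univ] at h
  exact h

theorem chartMv_self (p : M) (P : MvField E M) :
    chartMv p P (extChartAt 𝓘(ℝ, E) p p) = mvAt P p := by
  have e : (extChartAt 𝓘(ℝ, E) p).symm (extChartAt 𝓘(ℝ, E) p p) = p := extChartAt_to_inv p
  rw [chartMv_apply, chartDeriv_self, ContinuousLinearMap.inverse_id, ContinuousLinearMap.coe_id,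
    ExteriorAlgebra.map_id, AlgHom.id_apply, e]

theorem chartForm_self (p : M) (w : FormField E M) :
    chartForm p w (extChartAt 𝓘(ℝ, E) p p) = formAt w p := by
  have e : (extChartAt 𝓘(ℝ, E) p).symm (extChartAt 𝓘(ℝ, E) p p) = p := extChartAt_to_inv p
  rw [chartForm_apply, chartDeriv_self, e]
  rfl

theorem chartDerivAt_eq_id (p : M) : chartDerivAt (E := E) p = ContinuousLinearMap.id ℝ E := by
  have : IsManifold 𝓘(ℝ, E) 1 M := IsManifold.of_le (n := ∞) (by norm_num)
  exact mfderiv_extChartAt_self (I := 𝓘(ℝ, E)) (x := p)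

theorem formAt_d (p : M) (w : FormField E M) :
    formAt (d w) p = extDerivAt (chartForm p w) (extChartAt 𝓘(ℝ, E) p p) := by
  have e : formAt (d w) p = AltForms.comp (chartDerivAt (E := E) p)
    (extDerivAt (chartForm p w) (extChartAt 𝓘(ℝ, E) p p)) := rfl
  rw [e, chartDerivAt_eq_id]
  rfl

/-- By naturality of the contraction, since multivectors are pulled back through the inverse
derivative. Invertibility is known on the chart target, hence the restriction on `z`. -/
theorem chartForm_contract (p : M) (P : MvField E M) (w : FormField E M) {z : E}
    (hz : z ∈ (extChartAt 𝓘(ℝ, E) p).target) :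
    chartForm p (contract P w) z = contractMultivector E (chartMv p P z) (chartForm p w z) := by
  rw [chartForm_apply, chartForm_apply, formAt_contract, ← AltForms.comp_contractMultivector,
    chartMv_apply]
  have e : (ExteriorAlgebra.map (chartDeriv p z : E →ₗ[ℝ] E))
      (ExteriorAlgebra.map ((chartDeriv p z).inverse : E →ₗ[ℝ] E)
        (mvAt P ((extChartAt 𝓘(ℝ, E) p).symm z))) =
      (mvAt P ((extChartAt 𝓘(ℝ, E) p).symm z)) := by
    rw [← AlgHom.comp_apply, ExteriorAlgebra.map_comp_map,
      show (chartDeriv p z : E →ₗ[ℝ] E) ∘ₗ ((chartDeriv p z).inverse : E →ₗ[ℝ] E) =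
        (((chartDeriv p z).comp (chartDeriv p z).inverse : E →L[ℝ] E) : E →ₗ[ℝ] E) from rfl,
      (chartDeriv_isInvertible p hz).self_comp_inverse, ContinuousLinearMap.coe_id,
      ExteriorAlgebra.map_id, AlgHom.id_apply]
  rw [e]

/-- The exterior derivative depends only on the germ of the form, so `chartForm_contract` on the
chart target, a neighbourhood of the image of `p`, is enough. -/
theorem formAt_lieDerivative (a : ℕ) (p : M) (P : MvField E M) (w : FormField E M) :
    formAt (lieDerivative a P w) p =
      lieModel a (chartMv p P) (chartForm p w) (extChartAt 𝓘(ℝ, E) p p) := by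
  have e : formAt (lieDerivative a P w) p = formAt (d (contract P w)) p -
    (-1 : ℝ) ^ a • contractMultivector E (mvAt P p) (formAt (d w) p) := rfl
  rw [e, formAt_d, formAt_d, lieModel, chartMv_self]
  congr 1
  refine extDerivAt_congr ?_
  filter_upwards [extChartAt_target_mem_nhds (I := 𝓘(ℝ, E)) p] with z hz
  exact chartForm_contract p P w hz

theorem mvAt_list_prod {n : ℕ} (p : M) (P : Fin n → MvField E M) :
    mvAt (List.ofFn P).prod p =
      (List.ofFn fun i => chartMv p (P i) (extChartAt 𝓘(ℝ, E) p p)).prod := by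
  rw [← chartMv_list_prod, chartMv_self]

variable [FiniteDimensional ℝ E]

theorem mvAt_nu (p : M) (P Q : MvField E M) :
    mvAt (nu P Q) p = nuModel (chartMv p P) (chartMv p Q) (extChartAt 𝓘(ℝ, E) p p) := by
  have e : mvAt (nu P Q) p = mvAt (MvField.pullback (extChartAt 𝓘(ℝ, E) p)
    (nuModel (chartMv p P) (chartMv p Q) : MvField E E)) p := rfl
  rw [e, mvAt_pullback, chartDerivAt_eq_id, ContinuousLinearMap.inverse_id, ContinuousLinearMap.coe_id,
    ExteriorAlgebra.map_id, AlgHom.id_apply]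

theorem mvAt_higherNu {n : ℕ} {a : Fin (n + 1) → ℕ} {P : Fin (n + 1) → MvField E M}
    (hPa : ∀ i p, P i p ∈ ⋀[ℝ]^(a i) (TangentSpace 𝓘(ℝ, E) p)) (hP : ∀ i, (P i).IsSmooth) (p : M) :
    mvAt (higherNu (n + 1) a P) p =
      nuRec (n + 1) a (fun i => chartMv p (P i)) (extChartAt 𝓘(ℝ, E) p p) := by
  cases n with
  | zero => rfl
  | succ n =>
    rw [nuRec_eq_sum (fun i => chartMv_mem (hPa i) p) fun i => chartMv_differentiableAt (hP i) p,
      higherNu, sum_unshuffles_two, mvAt, Finset.sum_apply]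
    refine Finset.sum_congr rfl fun q _ => ?_
    rw [Finset.sum_apply]
    refine Finset.sum_congr rfl fun r _ => ?_
    split_ifs with h
    · rw [koszulSign_permTwo, permTwo_zero, permTwo_one]
      simp only [permTwo_succ_succ]
      rw [← mvAt_nu, ← mvAt_list_prod]
      rfl
    · rfl

/-- At each point `p`, every term equals its counterpart in the preferred chart at `p`, so this is
`lieModel_list_prod` at the image of `p`. Independence of the chart is never needed. -/
theorem lieDerivative_list_prod_sub_contract {n : ℕ} {a : Fin (n + 1) → ℕ}
    {P : Fin (n + 1) → MvField E M}
    (hPa : ∀ i p, P i p ∈ ⋀[ℝ]^(a i) (TangentSpace 𝓘(ℝ, E) p)) (hP : ∀ i, (P i).IsSmooth)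
    {w : FormField E M} (hw : w.IsSmooth) :
    lieDerivative (∑ i, a i) (List.ofFn P).prod w - contract (higherNu (n + 1) a P) w =
      (-1 : ℝ) ^ (∑ i, a i) • ∑ σ ∈ unshuffles n (n + 1),
        (koszulSign a σ * (-1 : ℝ) ^ a (σ (Fin.last n))) •
          contract (List.ofFn fun i : Fin n => P (σ i.castSucc)).prod
            (lieDerivative (a (σ (Fin.last n))) (P (σ (Fin.last n))) w) := by
  rw [sum_unshuffles_last]
  simp only [permLast_last, permLast_castSucc, koszulSign_permLast, Finset.smul_sum, smul_smul]
  rw [sub_eq_iff_eq_add']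
  funext p
  have e : chartMv p (List.ofFn P).prod = fun z => (List.ofFn fun i => chartMv p (P i) z).prod :=
    funext (chartMv_list_prod p P)
  have h := formAt_lieDerivative (∑ i, a i) p (List.ofFn P).prod w
  rw [e, lieModel_list_prod (fun i => chartMv_mem (hPa i) p)
    (fun i => chartMv_differentiableAt (hP i) p) (chartForm_differentiableAt hw p),
    ← mvAt_higherNu hPa hP, chartForm_self] at h
  refine h.trans ?_
  rw [Pi.add_apply, Finset.sum_apply]
  refine congrArg₂ (fun u v : AltForms E => u + v) rfl (Finset.sum_congr rfl fun q _ => ?_)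
  rw [← formAt_lieDerivative, ← mvAt_list_prod, pow_add, pow_add, mul_assoc]
  rfl

end Chart

end Multisymplectic

end

/-! ### The theorem: general, closed and multisymplectic cases -/

open Multisymplectic in
theorem proposition2p3 {E : Type*} [NormedAddCommGroup E] [NormedSpace ℝ E] [FiniteDimensional ℝ E]
    {M : Type*} [TopologicalSpace M] [ChartedSpace E M]
    [IsManifold 𝓘(ℝ, E) ∞ M]
    (n : ℕ) (a : Fin (n + 1) → ℕ) (x : (i : Fin (n + 1)) → MultivectorField E M (a i)) :
    (∀ w : FormField E M, w.IsSmooth →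
      lieDerivative (∑ i, a i) (List.ofFn fun i => (x i).toFun).prod w
          - contract (higherNu (n + 1) a fun i => (x i).toFun) w =
        (-1 : ℝ) ^ (∑ i, a i) • ∑ σ ∈ unshuffles n (n + 1),
          (koszulSign a σ * (-1 : ℝ) ^ a (σ (Fin.last n))) •
            contract (List.ofFn fun i : Fin n => (x (σ i.castSucc)).toFun).prod
              (lieDerivative (a (σ (Fin.last n))) (x (σ (Fin.last n))).toFun w)) ∧
    (∀ (m : ℕ) (w : FormField E M), w.IsSmooth → w.IsHomogeneous (m + 1) → d w = 0 →
      (d (contract (List.ofFn fun i => (x i).toFun).prod w)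
          - contract (higherNu (n + 1) a fun i => (x i).toFun) w =
        (-1 : ℝ) ^ (∑ i, a i) • ∑ σ ∈ unshuffles n (n + 1),
          (koszulSign a σ * (-1 : ℝ) ^ a (σ (Fin.last n))) •
            contract (List.ofFn fun i : Fin n => (x (σ i.castSucc)).toFun).prod
              (d (contract (x (σ (Fin.last n))).toFun w))) ∧
      ((∀ i, lieDerivative (a i) (x i).toFun w = 0) →
        d (contract (List.ofFn fun i => (x i).toFun).prod w) =
          contract (higherNu (n + 1) a fun i => (x i).toFun) w)) := by
  have key : ∀ w : FormField E M, w.IsSmooth → _ := fun w hw =>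
    lieDerivative_list_prod_sub_contract (fun i => (x i).mem_exteriorPower)
      (fun i => (x i).isSmooth) hw
  refine ⟨key, fun m w hw _ hd => ⟨?_, fun hx => ?_⟩⟩
  -- As `d w = 0`, the term `ι d w` disappears from every Lie derivative, on both sides.
  · simpa only [lieDerivative_of_closed _ _ hd] using key w hw
  · have h := key w hw
    simp only [hx, lieDerivative_of_closed (∑ i, a i) _ hd, contract_zero, smul_zero,
      Finset.sum_const_zero] at h
    exact sub_eq_zero.1 h
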